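/- Let $Q\to\mathbb R$ be a smooth fibre bundle (locally trivial, with an arbitrary finite-dimensional smooth manifold $M$ as typical fibre) with time function $t$, and let $V^*Q\to Q$ be its vertical cotangent bundle, i.e. the dual of the bundle $VQ=\ker dt\subset TQ$, with holonomic coordinates $(t,q^i,p_i)$. The composite $V^*Q\to Q\to\mathbb R$ is called the Legendre bundle. Let $\Xi$ be the Liouville form on $T^*Q$ and let $$\boldsymbol\Omega=h^*(d\Xi\wedge dt)=d\bigl(h^*(\Xi\wedge dt)\bigr)=dp_i\wedge dq^i\wedge dt$$ be the canonical 3-form on $V^*Q$; it does not depend on the choice of the section $h$ of the canonical projection $T^*Q\to V^*Q$. Let $\gamma$ be a connection on the Legendre bundle $V^*Q\to\mathbb R$, i.e. a smooth vector field $\gamma$ on $V^*Q$ with $\gamma\rfloor dt=1$. If $\gamma$ is canonical, i.e. the 2-form $\gamma\rfloor\boldsymbol\Omega$ is closed, then $\gamma\rfloor\boldsymbol\Omega$ is exact: there is a smooth 1-form $\eta$ on the whole of $V^*Q$ with $d\eta=\gamma\rfloor\boldsymbol\Omega$. -/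

import Mathlib

open Set Bundle Function
open scoped Manifold ContDiff Topology

noncomputable section

/-! ### Differential forms on a manifold without boundary -/

section Forms

variable {F H P : Type*} [NormedAddCommGroup F] [NormedSpace ℝ F] [TopologicalSpace H]
  [TopologicalSpace P] [ChartedSpace H P]

/-- A (not necessarily smooth) real differential `k`-form on the manifold `P`. -/
abbrev DiffForm (I : ModelWithCorners ℝ F H) (P : Type*) [TopologicalSpace P] [ChartedSpace H P]
    (k : ℕ) : Type _ :=
  ∀ z : P, TangentSpace I z [⋀^Fin k]→L[ℝ] ℝ

namespace DiffForm

variable {I : ModelWithCorners ℝ F H} {k : ℕ}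

/-- The coordinate expression of a form in the preferred chart around `z₀`: its pull-back to the
model vector space along the inverse of that chart. -/
def inChart (α : DiffForm I P k) (z₀ : P) : F → F [⋀^Fin k]→L[ℝ] ℝ := fun y =>
  (α ((extChartAt I z₀).symm y)).compContinuousLinearMap
    (mfderiv 𝓘(ℝ, F) I (extChartAt I z₀).symm y)

/-- A form is smooth if all its coordinate expressions are. -/
def IsSmooth (α : DiffForm I P k) : Prop :=
  ∀ z₀ : P, ContDiffOn ℝ ∞ (α.inChart z₀) (extChartAt I z₀).target

/-- The exterior derivative, computed at `z` in the preferred chart around `z`. -/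
def d (α : DiffForm I P k) : DiffForm I P (k + 1) := fun z =>
  (extDeriv (α.inChart z) (extChartAt I z z)).compContinuousLinearMap
    (mfderiv I 𝓘(ℝ, F) (extChartAt I z) z)

/-- `α` is closed: `dα = 0`. -/
def IsClosed (α : DiffForm I P k) : Prop := α.d = 0

/-- `α` is exact: `α = dη` for a smooth form `η` on the whole of `P`. -/
def IsExact (α : DiffForm I P (k + 1)) : Prop :=
  ∃ η : DiffForm I P k, η.IsSmooth ∧ η.d = α

/-- The contraction `X ⌋ α`, i.e. `(X ⌋ α)(v₁, …, v_k) = α(X, v₁, …, v_k)`. -/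
def contract (X : ∀ z : P, TangentSpace I z) (α : DiffForm I P (k + 1)) : DiffForm I P k :=
  fun z =>
    { toFun := fun v => α z (Fin.cons (X z) v)
      map_update_add' := by
        intro inst v i a b
        have : inst = instDecidableEqFin k := Subsingleton.elim _ _
        subst this
        simp only [Fin.cons_update]
        exact (α z).map_update_add _ _ _ _
      map_update_smul' := by
        intro inst v i c a
        have : inst = instDecidableEqFin k := Subsingleton.elim _ _
        subst this
        simp only [Fin.cons_update]
        exact (α z).map_update_smul _ _ _ _
      map_eq_zero_of_eq' := fun v i j hv hij =>
        (α z).map_eq_zero_of_eq _ (i := i.succ) (j := j.succ) (by simpa using hv)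
          (fun h => hij (Fin.succ_injective _ h))
      cont := (α z).cont.comp (by fun_prop) }

end DiffForm

end Forms

/-! ### Fibre bundles over the time axis -/

section Bundles

variable {E M Q : Type*} [NormedAddCommGroup E] [NormedSpace ℝ E]
  [TopologicalSpace M] [ChartedSpace E M] [TopologicalSpace Q] [ChartedSpace (ℝ × E) Q]

/-- A smooth (locally trivial) fibre bundle `Q → ℝ` with typical fibre `M`. -/
structure ConfigurationBundle (E M Q : Type*) [NormedAddCommGroup E] [NormedSpace ℝ E]
    [TopologicalSpace M] [ChartedSpace E M] [TopologicalSpace Q] [ChartedSpace (ℝ × E) Q] where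
  /-- the projection, i.e. the time function `t` on `Q` -/
  time : Q → ℝ
  contMDiff_time : ContMDiff 𝓘(ℝ, ℝ × E) 𝓘(ℝ, ℝ) ∞ time
  locally_trivial : ∀ t : ℝ, ∃ (U : Set ℝ) (φ : OpenPartialHomeomorph Q (ℝ × M)),
    IsOpen U ∧ t ∈ U ∧ φ.source = time ⁻¹' U ∧ φ.target = U ×ˢ univ ∧
    (∀ q ∈ φ.source, (φ q).1 = time q) ∧
    ContMDiffOn 𝓘(ℝ, ℝ × E) (𝓘(ℝ, ℝ).prod 𝓘(ℝ, E)) ∞ φ φ.source ∧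
    ContMDiffOn (𝓘(ℝ, ℝ).prod 𝓘(ℝ, E)) 𝓘(ℝ, ℝ × E) ∞ φ.symm φ.target

namespace ConfigurationBundle

/-- The differential `dt` at a point of `Q`. -/
abbrev dt (B : ConfigurationBundle E M Q) (q : Q) : TangentSpace 𝓘(ℝ, ℝ × E) q →L[ℝ] ℝ :=
  mfderiv 𝓘(ℝ, ℝ × E) 𝓘(ℝ, ℝ) B.time q

/-- The vertical tangent space `V_q Q = ker dt ⊆ T_q Q`. -/
abbrev VerticalSpace (B : ConfigurationBundle E M Q) (q : Q) : Type _ :=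
  LinearMap.ker (B.dt q).toLinearMap

/-- A smooth chart `(t, qⁱ)` of `Q` adapted to the fibration. -/
structure IsFibredChart (B : ConfigurationBundle E M Q)
    (e : OpenPartialHomeomorph Q (ℝ × E)) : Prop where
  contMDiffOn : ContMDiffOn 𝓘(ℝ, ℝ × E) 𝓘(ℝ, ℝ × E) ∞ e e.source
  contMDiffOn_symm : ContMDiffOn 𝓘(ℝ, ℝ × E) 𝓘(ℝ, ℝ × E) ∞ e.symm e.target
  fst_eq : ∀ q ∈ e.source, (e q).1 = B.time q

theorem exists_isFibredChart [IsManifold 𝓘(ℝ, E) ∞ M] (B : ConfigurationBundle E M Q) (q : Q) :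
    ∃ e : OpenPartialHomeomorph Q (ℝ × E), B.IsFibredChart e ∧ q ∈ e.source := by
  obtain ⟨U, φ, hU, ht, hs, htar, hfst, hφ, hφ'⟩ := B.locally_trivial (B.time q)
  have hq : q ∈ φ.source := by rw [hs]; exact ht
  let c := chartAt E (φ q).2
  have hc : ContMDiffOn 𝓘(ℝ, E) 𝓘(ℝ, E) ∞ c c.source := contMDiffOn_chart
  have hc' : ContMDiffOn 𝓘(ℝ, E) 𝓘(ℝ, E) ∞ c.symm c.target := contMDiffOn_chart_symm
  refine ⟨φ.trans ((OpenPartialHomeomorph.refl ℝ).prod c), ⟨?_, ?_, ?_⟩, ?_⟩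
  · have h : ContMDiffOn (𝓘(ℝ, ℝ).prod 𝓘(ℝ, E)) 𝓘(ℝ, ℝ × E) ∞
        (fun x : ℝ × M => (x.1, c x.2)) (univ ×ˢ c.source) :=
      ContMDiffOn.prodMk_space contMDiffOn_fst
        (hc.comp contMDiffOn_snd (fun x hx => hx.2))
    refine (h.comp (hφ.mono ?_) ?_)
    · intro x hx; exact hx.1
    · intro x hx; exact ⟨mem_univ _, hx.2.2⟩
  · have h : ContMDiffOn 𝓘(ℝ, ℝ × E) (𝓘(ℝ, ℝ).prod 𝓘(ℝ, E)) ∞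
        (fun x : ℝ × E => (x.1, c.symm x.2)) (univ ×ˢ c.target) :=
      ContMDiffOn.prodMk contDiff_fst.contMDiff.contMDiffOn
        (hc'.comp contDiff_snd.contMDiff.contMDiffOn (fun x hx => hx.2))
    refine (hφ'.comp (h.mono ?_) ?_)
    · intro x hx; exact ⟨mem_univ _, hx.1.2⟩
    · intro x hx; exact hx.2
  · intro x hx
    exact hfst x hx.1
  · exact ⟨hq, trivial, mem_chart_source E _⟩


variable {B : ConfigurationBundle E M Q} {e e' : OpenPartialHomeomorph Q (ℝ × E)}

namespace IsFibredChart

theorem mdifferentiableAt (he : B.IsFibredChart e) {q : Q} (hq : q ∈ e.source) :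
    MDifferentiableAt 𝓘(ℝ, ℝ × E) 𝓘(ℝ, ℝ × E) e q :=
  (he.contMDiffOn.contMDiffAt (e.open_source.mem_nhds hq)).mdifferentiableAt (by simp)

theorem mdifferentiableAt_symm (he : B.IsFibredChart e) {y : ℝ × E} (hy : y ∈ e.target) :
    MDifferentiableAt 𝓘(ℝ, ℝ × E) 𝓘(ℝ, ℝ × E) e.symm y :=
  (he.contMDiffOn_symm.contMDiffAt (e.open_target.mem_nhds hy)).mdifferentiableAt (by simp)

/-- The differential of a fibred chart, as a map to the model space. -/
abbrev D (e : OpenPartialHomeomorph Q (ℝ × E)) (q : Q) :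
    TangentSpace 𝓘(ℝ, ℝ × E) q →L[ℝ] ℝ × E :=
  mfderiv 𝓘(ℝ, ℝ × E) 𝓘(ℝ, ℝ × E) e q

theorem D_fst (he : B.IsFibredChart e) {q : Q} (hq : q ∈ e.source)
    (w : TangentSpace 𝓘(ℝ, ℝ × E) q) : (D e q w).1 = B.dt q w := by
  have h1 : HasMFDerivAt 𝓘(ℝ, ℝ × E) 𝓘(ℝ, ℝ) (fun q => (e q).1) q
      ((ContinuousLinearMap.fst ℝ ℝ E).comp (D e q)) :=
    HasMFDerivAt.comp q ((ContinuousLinearMap.fst ℝ ℝ E).hasFDerivAt.hasMFDerivAt)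
      (he.mdifferentiableAt hq).hasMFDerivAt
  have h2 : HasMFDerivAt 𝓘(ℝ, ℝ × E) 𝓘(ℝ, ℝ) B.time q
      ((ContinuousLinearMap.fst ℝ ℝ E).comp (D e q)) := by
    refine h1.congr_of_eventuallyEq ?_
    filter_upwards [e.open_source.mem_nhds hq] with x hx using (he.fst_eq x hx).symm
  have := h2.mfderiv
  exact (DFunLike.congr_fun this w).symm

theorem mdifferentiable (he : B.IsFibredChart e) :
    e.MDifferentiable 𝓘(ℝ, ℝ × E) 𝓘(ℝ, ℝ × E) :=
  ⟨fun _ hx => (he.mdifferentiableAt hx).mdifferentiableWithinAt,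
    fun _ hx => (he.mdifferentiableAt_symm hx).mdifferentiableWithinAt⟩

theorem D_isInvertible (he : B.IsFibredChart e) {q : Q} (hq : q ∈ e.source) :
    (D e q).IsInvertible :=
  ⟨he.mdifferentiable.mfderiv hq, rfl⟩

theorem dt_inverse (he : B.IsFibredChart e) {q : Q} (hq : q ∈ e.source) (y : ℝ × E) :
    B.dt q ((D e q).inverse y) = y.1 := by
  rw [← he.D_fst hq]
  exact congrArg Prod.fst ((he.D_isInvertible hq).self_apply_inverse y)

/-- The isomorphism `V_q Q ≃ E`, `q̇ⁱ ∂ᵢ ↦ (q̇ⁱ)`, given by a fibred chart. -/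
def vertEquiv (he : B.IsFibredChart e) {q : Q} (hq : q ∈ e.source) :
    B.VerticalSpace q ≃L[ℝ] E where
  toFun w := (D e q w.1).2
  map_add' w w' := by simp
  map_smul' c w := by simp
  invFun v := ⟨(D e q).inverse (0, v), he.dt_inverse hq _⟩
  left_inv w := by
    apply Subtype.ext
    have h : ((0 : ℝ), (D e q w.1).2) = D e q w.1 :=
      Prod.ext (((he.D_fst hq w.1).trans w.2).symm) rfl
    change (D e q).inverse (0, (D e q w.1).2) = w.1
    rw [h]
    exact (he.D_isInvertible hq).inverse_apply_self _
  right_inv v := congrArg Prod.snd ((he.D_isInvertible hq).self_apply_inverse (0, v))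
  continuous_toFun := by fun_prop
  continuous_invFun := by
    refine Continuous.subtype_mk ?_ _
    fun_prop

open Classical in
/-- The trivialization `(t, qⁱ, q̇ⁱ)` of `VQ` over the domain of a fibred chart. -/
def pretrivialization (he : B.IsFibredChart e) :
    Pretrivialization E (π E B.VerticalSpace) where
  toFun w := (w.proj, (D e w.proj w.2.1).2)
  invFun y := ⟨y.1, if h : B.dt y.1 ((D e y.1).inverse (0, y.2)) = 0 then
    ⟨(D e y.1).inverse (0, y.2), h⟩ else 0⟩
  source := π E B.VerticalSpace ⁻¹' e.source
  target := e.source ×ˢ univ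
  map_source' w hw := ⟨hw, mem_univ _⟩
  map_target' y hy := hy.1
  left_inv' := by
    rintro ⟨q, w⟩ hq
    have h := congrArg Subtype.val ((he.vertEquiv hq).left_inv w)
    have h0 := he.dt_inverse hq (0, (D e q w.1).2)
    dsimp only
    rw [dif_pos h0]
    exact congrArg (TotalSpace.mk q) (Subtype.ext h)
  right_inv' := by
    rintro ⟨q, v⟩ ⟨hq, -⟩
    have h := (he.vertEquiv hq).right_inv v
    have h0 := he.dt_inverse hq (0, v)
    dsimp only
    rw [dif_pos h0]
    exact Prod.ext rfl h
  open_target := e.open_source.prod isOpen_univ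
  baseSet := e.source
  open_baseSet := e.open_source
  source_eq := rfl
  target_eq := rfl
  proj_toFun _ _ := rfl

theorem pretrivialization_apply (he : B.IsFibredChart e) (q : Q) (w : B.VerticalSpace q) :
    he.pretrivialization ⟨q, w⟩ = (q, (D e q w.1).2) := rfl

theorem pretrivialization_symm (he : B.IsFibredChart e) {q : Q} (hq : q ∈ e.source) (v : E) :
    he.pretrivialization.symm q v = (he.vertEquiv hq).symm v := by
  have h := he.pretrivialization.symm_apply_apply_mk (b := q) hq ((he.vertEquiv hq).symm v)
  rw [pretrivialization_apply] at h
  rw [← h]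
  congr 1
  exact ((he.vertEquiv hq).right_inv v).symm

theorem contMDiffOn_coordChange (he : B.IsFibredChart e) (he' : B.IsFibredChart e') :
    ContMDiffOn 𝓘(ℝ, ℝ × E) 𝓘(ℝ, E →L[ℝ] E) ∞
      (fun q => (ContinuousLinearMap.snd ℝ ℝ E).comp
        ((fderiv ℝ (e' ∘ e.symm) (e q)).comp (ContinuousLinearMap.inr ℝ ℝ E)))
      (e.source ∩ e'.source) := by
  have h1 : ContDiffOn ℝ ∞ (e' ∘ e.symm) (e.symm.trans e').source := by
    rw [← contMDiffOn_iff_contDiffOn]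
    refine he'.contMDiffOn.comp (he.contMDiffOn_symm.mono ?_) ?_
    · intro y hy; exact hy.1
    · intro y hy; exact hy.2
  have h2 : ContDiffOn ℝ ∞ (fderiv ℝ (e' ∘ e.symm)) (e.symm.trans e').source :=
    h1.fderiv_of_isOpen (e.symm.trans e').open_source (by simp)
  have h3 : ContDiffOn ℝ ∞ (fun y => (ContinuousLinearMap.snd ℝ ℝ E).comp
        ((fderiv ℝ (e' ∘ e.symm) y).comp (ContinuousLinearMap.inr ℝ ℝ E)))
      (e.symm.trans e').source :=
    contDiffOn_const.clm_comp (h2.clm_comp contDiffOn_const)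
  refine h3.contMDiffOn.comp (he.contMDiffOn.mono inter_subset_left) ?_
  intro q hq
  exact ⟨e.map_source hq.1, by simpa [e.left_inv hq.1] using hq.2⟩

theorem coordChange_apply (he : B.IsFibredChart e) (he' : B.IsFibredChart e') {q : Q}
    (hq : q ∈ e.source ∩ e'.source) (v : E) :
    (ContinuousLinearMap.snd ℝ ℝ E).comp
        ((fderiv ℝ (e' ∘ e.symm) (e q)).comp (ContinuousLinearMap.inr ℝ ℝ E)) v =
      (he'.pretrivialization ⟨q, he.pretrivialization.symm q v⟩).2 := by
  rw [he.pretrivialization_symm hq.1, pretrivialization_apply]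
  change (fderiv ℝ (e' ∘ e.symm) (e q) (0, v)).2 = (D e' q ((D e q).inverse (0, v))).2
  have hs : HasMFDerivAt 𝓘(ℝ, ℝ × E) 𝓘(ℝ, ℝ × E) ((e' ∘ e.symm) ∘ e) q
      (ContinuousLinearMap.comp (fderiv ℝ (e' ∘ e.symm) (e q)) (D e q)) := by
    have hd : DifferentiableAt ℝ (e' ∘ e.symm) (e q) := by
      rw [← mdifferentiableAt_iff_differentiableAt]
      refine MDifferentiableAt.comp (I' := 𝓘(ℝ, ℝ × E)) (e q) ?_
        (he.mdifferentiableAt_symm (e.map_source hq.1))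
      rw [e.left_inv hq.1]
      exact he'.mdifferentiableAt hq.2
    exact HasMFDerivAt.comp q hd.hasFDerivAt.hasMFDerivAt
      (he.mdifferentiableAt hq.1).hasMFDerivAt
  have hs' : HasMFDerivAt 𝓘(ℝ, ℝ × E) 𝓘(ℝ, ℝ × E) e' q
      (ContinuousLinearMap.comp (fderiv ℝ (e' ∘ e.symm) (e q)) (D e q)) := by
    refine hs.congr_of_eventuallyEq ?_
    filter_upwards [e.open_source.mem_nhds hq.1] with x hx
    simp [e.left_inv hx]
  have := congrArg Prod.snd
    (DFunLike.congr_fun hs'.mfderiv ((D e q).inverse ((0 : ℝ), v)))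
  refine Eq.trans ?_ this.symm
  change _ = (fderiv ℝ (e' ∘ e.symm) (e q) (D e q ((D e q).inverse ((0 : ℝ), v)))).2
  rw [(he.D_isInvertible hq.1).self_apply_inverse]

end IsFibredChart

variable (B)

/-- The Legendre bundle `V*Q`: the vertical cotangent bundle of `Q → ℝ`, i.e. the dual bundle of
`VQ → Q`, with the topology and the smooth structure of a dual bundle. -/
abbrev Legendre : Type _ :=
  TotalSpace (E →L[ℝ] ℝ) (fun q : Q => B.VerticalSpace q →L[ℝ] Trivial Q ℝ q)

/-- The model of `V*Q`, with coordinates `(t, qⁱ, pᵢ)`. -/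
abbrev LegendreModel (E : Type*) [NormedAddCommGroup E] [NormedSpace ℝ E] :
    ModelWithCorners ℝ ((ℝ × E) × (E →L[ℝ] ℝ)) (ModelProd (ℝ × E) (E →L[ℝ] ℝ)) :=
  𝓘(ℝ, ℝ × E).prod 𝓘(ℝ, E →L[ℝ] ℝ)

variable [IsManifold 𝓘(ℝ, E) ∞ M]

/-- The vertical tangent bundle `VQ → Q`, with the trivializations given by all fibred charts. -/
def verticalPrebundle : VectorPrebundle ℝ E B.VerticalSpace where
  pretrivializationAtlas := {p | ∃ (e : OpenPartialHomeomorph Q (ℝ × E)) (he : B.IsFibredChart e),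
    p = he.pretrivialization}
  pretrivialization_linear' := by
    rintro _ ⟨e, he, rfl⟩
    exact ⟨fun q hq => (he.vertEquiv hq).toLinearEquiv.toLinearMap.isLinear⟩
  pretrivializationAt q := (B.exists_isFibredChart q).choose_spec.1.pretrivialization
  mem_base_pretrivializationAt q := (B.exists_isFibredChart q).choose_spec.2
  pretrivialization_mem_atlas q := ⟨_, _, rfl⟩
  exists_coordChange := by
    rintro _ ⟨e, he, rfl⟩ _ ⟨e', he', rfl⟩
    exact ⟨_, (he.contMDiffOn_coordChange he').continuousOn,
      fun q hq v => he.coordChange_apply he' hq v⟩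
  totalSpaceMk_isInducing q := by
    have hq := (B.exists_isFibredChart q).choose_spec.2
    have he := (B.exists_isFibredChart q).choose_spec.1
    exact (isInducing_prodMkRight q).comp (he.vertEquiv hq).toHomeomorph.isInducing

instance : TopologicalSpace (TotalSpace E B.VerticalSpace) :=
  B.verticalPrebundle.totalSpaceTopology

instance : FiberBundle E B.VerticalSpace := B.verticalPrebundle.toFiberBundle

instance : VectorBundle ℝ E B.VerticalSpace := B.verticalPrebundle.toVectorBundle

instance : B.verticalPrebundle.IsContMDiff 𝓘(ℝ, ℝ × E) ∞ where
  exists_contMDiffCoordChange := by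
    rintro _ ⟨e, he, rfl⟩ _ ⟨e', he', rfl⟩
    exact ⟨_, he.contMDiffOn_coordChange he', fun q hq v => he.coordChange_apply he' hq v⟩

instance : ContMDiffVectorBundle ∞ E B.VerticalSpace 𝓘(ℝ, ℝ × E) :=
  B.verticalPrebundle.contMDiffVectorBundle 𝓘(ℝ, ℝ × E)

instance [IsManifold 𝓘(ℝ, ℝ × E) ∞ Q] : IsManifold (LegendreModel E) ∞ B.Legendre := inferInstance

/-- The projection `V*Q → ℝ`. -/
def legendreTime (z : B.Legendre) : ℝ := B.time z.proj

/-- For `α ∈ V*_q Q`, the 2-form `(u₀, u₁) ↦ α (dt(u₁) u₀ - dt(u₀) u₁)` on `T_q Q`. It is `a ∧ dt`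
for every extension `a : T_q Q → ℝ` of `α`. -/
def wedgeDt (q : Q) (α : B.VerticalSpace q →L[ℝ] ℝ) :
    TangentSpace 𝓘(ℝ, ℝ × E) q [⋀^Fin 2]→L[ℝ] ℝ where
  toFun u := α ⟨B.dt q (u 1) • u 0 - B.dt q (u 0) • u 1, by simp; ring⟩
  map_update_add' := by
    intro inst u i x y
    have : inst = instDecidableEqFin 2 := Subsingleton.elim _ _
    subst this
    rw [← map_add]
    congr 1
    apply Subtype.ext
    fin_cases i <;> simp [add_smul] <;> abel
  map_update_smul' := by
    intro inst u i c x
    have : inst = instDecidableEqFin 2 := Subsingleton.elim _ _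
    subst this
    rw [← map_smul]
    congr 1
    apply Subtype.ext
    fin_cases i <;> simp [smul_sub, mul_smul, smul_comm c]
  map_eq_zero_of_eq' := by
    intro u i j hu hij
    have h : u 0 = u 1 := by
      fin_cases i <;> fin_cases j <;> simp_all
    exact (congrArg α (Subtype.ext (by simp [h]))).trans α.map_zero
  cont := by
    refine α.continuous.comp (Continuous.subtype_mk ?_ _)
    fun_prop

/-- The canonical 2-form `Θ = h*(Ξ ∧ dt)` of `V*Q`, in coordinates `pᵢ dqⁱ ∧ dt`. Here `Ξ` is the
Liouville form of `T*Q` and `h` any section of `T*Q → V*Q`; as `h(q, α)` is an extension of `α` to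
`T_q Q`, the value of `h*(Ξ ∧ dt)` at `(q, α)` is the pull-back of `h(q, α) ∧ dt` under the
differential of `V*Q → Q`, whatever `h` is. -/
def Theta : DiffForm (LegendreModel E) B.Legendre 2 := fun z =>
  (B.wedgeDt z.proj z.2).compContinuousLinearMap
    (mfderiv (LegendreModel E) 𝓘(ℝ, ℝ × E) (fun z : B.Legendre => z.proj) z)

/-- The canonical 3-form `Ω = h*(dΞ ∧ dt) = d(h*(Ξ ∧ dt)) = dΘ` of `V*Q`, in coordinates
`dpᵢ ∧ dqⁱ ∧ dt`. -/
def Omega : DiffForm (LegendreModel E) B.Legendre 3 := B.Theta.d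

/-- A connection on `V*Q → ℝ`, given by its horizontal vector field: a smooth vector field `γ` on
`V*Q` with `γ ⌋ dt = 1`. -/
structure LegendreConnection [IsManifold 𝓘(ℝ, ℝ × E) ∞ Q] where
  /-- the horizontal vector field `γ = ∂ₜ + γⁱ ∂ᵢ + γᵢ ∂ⁱ` -/
  field : ∀ z : B.Legendre, TangentSpace (LegendreModel E) z
  contMDiff_field : ContMDiff (LegendreModel E) (LegendreModel E).tangent ∞
    (fun z => (⟨z, field z⟩ : TangentBundle (LegendreModel E) B.Legendre))
  dt_field : ∀ z, (mfderiv (LegendreModel E) 𝓘(ℝ, ℝ) B.legendreTime z (field z) : ℝ) = 1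

variable {B} in
/-- The connection `γ` is canonical: the form `γ ⌋ Ω` is closed. -/
def LegendreConnection.IsCanonical [IsManifold 𝓘(ℝ, ℝ × E) ∞ Q] (γ : B.LegendreConnection) :
    Prop :=
  (B.Omega.contract γ.field).IsClosed

end ConfigurationBundle
end Bundles
end

/-! Write α = γ⌋Ω. Since M is arbitrary, V*Q may have cohomology, so closedness alone is not enough;
what helps is that α pulls back to zero along any map into the zero section over one fixed time. In
coordinates Ω = dpᵢ ∧ dqⁱ ∧ dt, and both dpᵢ and dt kill vectors tangent to that set. The vector γ
can occupy only one slot of Ω, so in every term some dpᵢ or dt is left to be evaluated on such a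
vector.

It remains to deform the identity of V*Q smoothly to a map into that set. Two homotopies do this:
fibrewise scaling from the identity down to the zero section, and then, inside the zero section, the
contraction of Q onto its fibre over time 0. A homotopy operator K for G satisfies d(Kα) = G₁*α −
G₀*α when α is closed. The sum of the two operators applied to α is the primitive: the intermediate
terms cancel and the last pull-back vanishes (`pullback_contract_Omega_eq_zero`).

Three ingredients carry the argument. The homotopy formula (`IsClosed.d_homotopyOperator`) rests on
naturality of d (`IsSmooth.extDeriv_pull`) and on differentiation under the integral sign. The
contraction of Q (`exists_contraction`) comes from triviality of bundles over ℝ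
(`IsProductOver.exists_univ`), obtained by gluing local product structures along the time axis, with
neither a complete connection nor a partition of unity. Finally, Ω is computed in the coordinates
(t, qⁱ, pᵢ) (`Omega_eq_pullTo`). -/

noncomputable section

/-! ### Smooth dependence of alternating maps on parameters. -/

section VectorSpaceForms

variable {V W : Type*} [NormedAddCommGroup V] [NormedSpace ℝ V]
  [NormedAddCommGroup W] [NormedSpace ℝ W] {k : ℕ}

namespace ContinuousAlternatingMap

/-- Averaged antisymmetrization, a continuous left inverse of the inclusion of alternating maps
into multilinear maps. -/
def antisymmetrize (V : Type*) [NormedAddCommGroup V] [NormedSpace ℝ V] (k : ℕ) :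
    ContinuousMultilinearMap ℝ (fun _ : Fin k => V) ℝ →L[ℝ] V [⋀^Fin k]→L[ℝ] ℝ :=
  LinearMap.mkContinuous
    { toFun := fun f => ((k.factorial : ℝ)⁻¹) • ContinuousMultilinearMap.alternatization f
      map_add' := fun f g => by simp
      map_smul' := fun c f => by
        ext v
        have h : ContinuousMultilinearMap.alternatization (c • f) v =
            c • ContinuousMultilinearMap.alternatization f v := by
          rw [ContinuousMultilinearMap.alternatization_apply_apply,
            ContinuousMultilinearMap.alternatization_apply_apply, Finset.smul_sum]
          exact Finset.sum_congr rfl fun σ _ => smul_comm _ c (f (v ∘ σ))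
        change ((k.factorial : ℝ)⁻¹) • ContinuousMultilinearMap.alternatization (c • f) v =
          c • ((k.factorial : ℝ)⁻¹) • ContinuousMultilinearMap.alternatization f v
        rw [h, smul_comm] }
    1 (fun f => by
      refine opNorm_le_bound _ (mul_nonneg zero_le_one (norm_nonneg f)) fun v => ?_
      change ‖((k.factorial : ℝ)⁻¹) • ContinuousMultilinearMap.alternatization f v‖ ≤ _
      rw [norm_smul, ContinuousMultilinearMap.alternatization_apply_apply, one_mul]
      have h : ‖∑ σ : Equiv.Perm (Fin k), Equiv.Perm.sign σ • f (v ∘ σ)‖ ≤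
          (k.factorial : ℝ) * (‖f‖ * ∏ i, ‖v i‖) := by
        refine (norm_sum_le _ _).trans ?_
        have : ∀ σ ∈ (Finset.univ : Finset (Equiv.Perm (Fin k))),
            ‖Equiv.Perm.sign σ • f (v ∘ σ)‖ ≤ ‖f‖ * ∏ i, ‖v i‖ := by
          intro σ _
          have h1 : ‖Equiv.Perm.sign σ • f (v ∘ σ)‖ = ‖f (v ∘ σ)‖ := by
            rcases Int.units_eq_one_or (Equiv.Perm.sign σ) with h | h <;> simp [h]
          rw [h1]
          refine (f.le_opNorm _).trans (le_of_eq ?_)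
          congr 1
          exact Equiv.prod_comp σ (fun i => ‖v i‖)
        refine (Finset.sum_le_sum this).trans (le_of_eq ?_)
        simp [Finset.card_univ, Fintype.card_perm]
      have hk : (0 : ℝ) < k.factorial := by exact_mod_cast k.factorial_pos
      rw [norm_inv, Real.norm_of_nonneg hk.le, inv_mul_le_iff₀ hk]
      exact h)

theorem antisymmetrize_toContinuousMultilinearMap (f : V [⋀^Fin k]→L[ℝ] ℝ) :
    antisymmetrize V k f.toContinuousMultilinearMap = f := by
  ext v
  change ((k.factorial : ℝ)⁻¹) •
    ContinuousMultilinearMap.alternatization f.toContinuousMultilinearMap v = f v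
  rw [ContinuousMultilinearMap.alternatization_apply_apply]
  have : ∀ σ : Equiv.Perm (Fin k),
      Equiv.Perm.sign σ • f.toContinuousMultilinearMap (v ∘ σ) = f v := by
    intro σ
    change Equiv.Perm.sign σ • f.toAlternatingMap (v ∘ σ) = f.toAlternatingMap v
    rw [f.toAlternatingMap.map_perm, smul_smul, Int.units_mul_self, one_smul]
  rw [Finset.sum_congr rfl fun σ _ => this σ, Finset.sum_const, Finset.card_univ,
    Fintype.card_perm, Fintype.card_fin, nsmul_eq_mul, smul_eq_mul, ← mul_assoc,
    inv_mul_cancel₀ (by exact_mod_cast k.factorial_ne_zero), one_mul]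

end ContinuousAlternatingMap

/-- For multilinear maps, composition is linear in `f` and polynomial in `L`, hence smooth. The
alternating case is recovered by applying `antisymmetrize`, a continuous linear left inverse of the
inclusion. -/
theorem ContDiffAt.continuousAlternatingMapComp {X : Type*} [NormedAddCommGroup X]
    [NormedSpace ℝ X] {n : WithTop ℕ∞} {f : X → W [⋀^Fin k]→L[ℝ] ℝ} {L : X → V →L[ℝ] W} {x : X}
    (hf : ContDiffAt ℝ n f x) (hL : ContDiffAt ℝ n L x) :
    ContDiffAt ℝ n (fun y => (f y).compContinuousLinearMap (L y)) x := by
  have h1 : ContDiffAt ℝ n (fun y =>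
      ContinuousMultilinearMap.compContinuousLinearMapContinuousMultilinear ℝ
      (fun _ : Fin k => V) (fun _ : Fin k => W) ℝ (fun _ => L y)
      (ContinuousAlternatingMap.toContinuousMultilinearMapCLM ℝ (f y))) x := by
    refine ContDiffAt.clm_apply ?_ ?_
    · exact (ContinuousMultilinearMap.contDiff _).contDiffAt.comp x
        (contDiffAt_pi.2 fun _ => hL)
    · exact (ContinuousLinearMap.contDiff _).contDiffAt.comp x hf
  refine ((ContinuousAlternatingMap.antisymmetrize V k).contDiff.contDiffAt.comp x
    h1).congr_of_eventuallyEq (Filter.Eventually.of_forall fun y => ?_)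
  exact (ContinuousAlternatingMap.antisymmetrize_toContinuousMultilinearMap _).symm

theorem ContDiffAt.curryLeft {X : Type*} [NormedAddCommGroup X] [NormedSpace ℝ X]
    {n : WithTop ℕ∞} {f : X → V [⋀^Fin (k + 1)]→L[ℝ] ℝ} {u : X → V} {x : X}
    (hf : ContDiffAt ℝ n f x) (hu : ContDiffAt ℝ n u x) :
    ContDiffAt ℝ n (fun y => (f y).curryLeft (u y)) x := by
  let T : (V [⋀^Fin (k + 1)]→L[ℝ] ℝ) →L[ℝ] V →L[ℝ] V [⋀^Fin k]→L[ℝ] ℝ :=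
    ContinuousAlternatingMap.curryLeftLI.toContinuousLinearMap
  exact (T.contDiff.contDiffAt.comp x hf).clm_apply hu

theorem ContDiffAt.extDeriv {θ : V → V [⋀^Fin k]→L[ℝ] ℝ} {x : V} (h : ContDiffAt ℝ ∞ θ x) :
    ContDiffAt ℝ ∞ (extDeriv θ) x :=
  (ContinuousAlternatingMap.alternatizeUncurryFinCLM ℝ V ℝ).contDiff.contDiffAt.comp x
    (h.fderiv_right (by simp))

end VectorSpaceForms

/-! ### Pull-backs and naturality of the exterior derivative. -/

section ManifoldForms

theorem minSmoothness_two_le_infty : minSmoothness ℝ 2 ≤ (∞ : WithTop ℕ∞) := by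
  rw [minSmoothness_of_isRCLikeNormedField]
  exact WithTop.coe_le_coe.2 (le_top : (2 : ℕ∞) ≤ ⊤)

variable {F H P V : Type*} [NormedAddCommGroup F] [NormedSpace ℝ F] [TopologicalSpace H]
  [TopologicalSpace P] [ChartedSpace H P] {I : ModelWithCorners ℝ F H}
  [NormedAddCommGroup V] [NormedSpace ℝ V] {k : ℕ}

namespace DiffForm

/-- The pull-back of a form on a manifold along a map from a vector space. -/
def pull (g : V → P) (α : DiffForm I P k) : V → V [⋀^Fin k]→L[ℝ] ℝ := fun y =>
  (α (g y)).compContinuousLinearMap (mfderiv 𝓘(ℝ, V) I g y)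

/-- The pull-back of a form on a vector space along a map from a manifold. -/
def pullTo (I : ModelWithCorners ℝ F H) (f : P → V) (θ : V → V [⋀^Fin k]→L[ℝ] ℝ) :
    DiffForm I P k := fun z =>
  (θ (f z)).compContinuousLinearMap (mfderiv I 𝓘(ℝ, V) f z)

theorem IsSmooth.add {α β : DiffForm I P k} (hα : α.IsSmooth) (hβ : β.IsSmooth) :
    IsSmooth (α + β : DiffForm I P k) := fun z₀ => (hα z₀).add (hβ z₀)

theorem inChart_congr {α β : DiffForm I P k} {z₀ : P} {y₀ : F}
    (hψ : ContinuousAt (extChartAt I z₀).symm y₀)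
    (h : ∀ᶠ z in 𝓝 ((extChartAt I z₀).symm y₀), α z = β z) :
    α.inChart z₀ =ᶠ[𝓝 y₀] β.inChart z₀ := by
  filter_upwards [hψ.eventually h] with y hy
  simp only [inChart, hy]

theorem contDiffAt_extChartAt_comp [IsManifold I ∞ P] {g : V → P} {y₀ : V} {z₀ : P}
    (hg : ContMDiffAt 𝓘(ℝ, V) I ∞ g y₀) (hz : g y₀ ∈ (chartAt H z₀).source) :
    ContDiffAt ℝ ∞ (extChartAt I z₀ ∘ g) y₀ :=
  ((contMDiffAt_extChartAt' hz).comp y₀ hg).contDiffAt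

variable [I.Boundaryless]

theorem extChartAt_target_mem_nhds_of_mem {z₀ : P} {y : F} (hy : y ∈ (extChartAt I z₀).target) :
    (extChartAt I z₀).target ∈ 𝓝 y :=
  (isOpen_extChartAt_target (I := I) z₀).mem_nhds hy

theorem IsSmooth.contDiffAt_inChart {α : DiffForm I P k} (hα : α.IsSmooth) {z₀ z : P}
    (hz : z ∈ (chartAt H z₀).source) :
    ContDiffAt ℝ ∞ (α.inChart z₀) (extChartAt I z₀ z) :=
  (hα z₀).contDiffAt (extChartAt_target_mem_nhds_of_mem
    ((extChartAt I z₀).map_source (by rwa [extChartAt_source])))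

theorem IsSmooth.d_add {α β : DiffForm I P k} (hα : α.IsSmooth) (hβ : β.IsSmooth) :
    DiffForm.d (α + β : DiffForm I P k) = α.d + β.d := by
  funext z
  have hz := mem_chart_source H z
  have := extDeriv_add ((hα.contDiffAt_inChart hz).differentiableAt (by simp))
    ((hβ.contDiffAt_inChart hz).differentiableAt (by simp))
  change (extDeriv (α.inChart z + β.inChart z) _).compContinuousLinearMap _ = _
  rw [this]
  rfl

variable [IsManifold I ∞ P]

theorem contMDiffAt_extChartAt_symm {z₀ : P} {y : F} (hy : y ∈ (extChartAt I z₀).target) :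
    ContMDiffAt 𝓘(ℝ, F) I ∞ (extChartAt I z₀).symm y :=
  (contMDiffOn_extChartAt_symm z₀).contMDiffAt (extChartAt_target_mem_nhds_of_mem hy)

/-- Around a point, a pull-back is the pull-back of the coordinate expression of the form. -/
theorem pull_eventuallyEq (α : DiffForm I P k) {g : V → P} {y₀ : V} {z₀ : P}
    (hg : ContMDiffAt 𝓘(ℝ, V) I ∞ g y₀) (hz : g y₀ ∈ (chartAt H z₀).source) :
    α.pull g =ᶠ[𝓝 y₀] fun y => (α.inChart z₀ (extChartAt I z₀ (g y))).compContinuousLinearMap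
      (fderiv ℝ (extChartAt I z₀ ∘ g) y) := by
  have hs : ∀ᶠ y in 𝓝 y₀, g y ∈ (chartAt H z₀).source :=
    hg.continuousAt ((chartAt H z₀).open_source.mem_nhds hz)
  have hd : ∀ᶠ y in 𝓝 y₀, ContMDiffAt 𝓘(ℝ, V) I 1 g y :=
    (contMDiffAt_iff_contMDiffAt_nhds (by simp)).1 (hg.of_le (by simp))
  filter_upwards [hs, hd, hs.eventually_nhds] with y hy hgy hny
  have hy' : g y ∈ (extChartAt I z₀).source := by rwa [extChartAt_source]
  have hφ : MDifferentiableAt I 𝓘(ℝ, F) (extChartAt I z₀) (g y) := mdifferentiableAt_extChartAt hy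
  have hgm : MDifferentiableAt 𝓘(ℝ, V) I g y := hgy.mdifferentiableAt (by simp)
  have hc : MDifferentiableAt 𝓘(ℝ, V) 𝓘(ℝ, F) (extChartAt I z₀ ∘ g) y := hφ.comp y hgm
  have hψ : MDifferentiableAt 𝓘(ℝ, F) I (extChartAt I z₀).symm (extChartAt I z₀ (g y)) :=
    (contMDiffAt_extChartAt_symm ((extChartAt I z₀).map_source hy')).mdifferentiableAt (by simp)
  have he : mfderiv 𝓘(ℝ, V) I g y =
      (mfderiv 𝓘(ℝ, F) I (extChartAt I z₀).symm (extChartAt I z₀ (g y))).comp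
        (fderiv ℝ (extChartAt I z₀ ∘ g) y) := by
    refine Eq.trans ?_ (Eq.trans (mfderiv_comp y hψ hc)
      (congrArg (ContinuousLinearMap.comp _) mfderiv_eq_fderiv))
    refine Filter.EventuallyEq.mfderiv_eq ?_
    filter_upwards [hny] with x hx
    exact ((extChartAt I z₀).left_inv (by rwa [extChartAt_source])).symm
  ext v
  change α (g y) _ = α ((extChartAt I z₀).symm (extChartAt I z₀ (g y))) _
  rw [(extChartAt I z₀).left_inv hy']
  refine congrArg (α (g y)) (funext fun i => ?_)
  exact DFunLike.congr_fun he (v i)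

theorem IsSmooth.contDiffAt_pull {α : DiffForm I P k} (hα : α.IsSmooth) {g : V → P} {y₀ : V}
    (hg : ContMDiffAt 𝓘(ℝ, V) I ∞ g y₀) : ContDiffAt ℝ ∞ (α.pull g) y₀ := by
  have hz := mem_chart_source H (g y₀)
  have hc := contDiffAt_extChartAt_comp (I := I) hg hz
  refine ContDiffAt.congr_of_eventuallyEq ?_ (pull_eventuallyEq α hg hz)
  refine ContDiffAt.continuousAlternatingMapComp ?_ (hc.fderiv_right (by simp))
  exact (hα.contDiffAt_inChart hz).comp y₀ hc

/-- The exterior derivative commutes with pull-back. -/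
theorem IsSmooth.extDeriv_pull {α : DiffForm I P k} (hα : α.IsSmooth) {g : V → P} {y₀ : V}
    (hg : ContMDiffAt 𝓘(ℝ, V) I ∞ g y₀) : extDeriv (α.pull g) y₀ = α.d.pull g y₀ := by
  have hz := mem_chart_source H (g y₀)
  have hc := contDiffAt_extChartAt_comp (I := I) hg hz
  rw [(pull_eventuallyEq α hg hz).extDeriv_eq]
  change extDeriv (fun y => (α.inChart (g y₀)
    ((extChartAt I (g y₀) ∘ g) y)).compContinuousLinearMap
      (fderiv ℝ (extChartAt I (g y₀) ∘ g) y)) y₀ = _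
  rw [extDeriv_pullback (f := extChartAt I (g y₀) ∘ g) (r := ∞)
    ((hα.contDiffAt_inChart hz).differentiableAt (by simp)) hc minSmoothness_two_le_infty]
  ext v
  refine congrArg (extDeriv (α.inChart (g y₀)) (extChartAt I (g y₀) (g y₀)))
    (funext fun i => ?_)
  have := mfderiv_comp y₀ (mdifferentiableAt_extChartAt (I := I) hz)
    (hg.mdifferentiableAt (by simp))
  rw [mfderiv_eq_fderiv] at this
  exact DFunLike.congr_fun this (v i)

/-- The form `α.d` is defined with a chart that varies with the point. Naturality under the inverse
of a fixed chart shows that its expression there is `extDeriv` of the expression of `α`, which is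
smooth. -/
theorem IsSmooth.d {α : DiffForm I P k} (hα : α.IsSmooth) : α.d.IsSmooth := by
  intro z₀ y hy
  have h := contMDiffAt_extChartAt_symm (I := I) hy
  refine ContDiffAt.contDiffWithinAt ?_
  refine (ContDiffAt.extDeriv (hα.contDiffAt_pull h)).congr_of_eventuallyEq ?_
  filter_upwards [extChartAt_target_mem_nhds_of_mem hy] with x hx
  exact (hα.extDeriv_pull (contMDiffAt_extChartAt_symm hx)).symm

theorem pull_pullTo_eventuallyEq {f : P → V} (θ : V → V [⋀^Fin k]→L[ℝ] ℝ) {z₀ : P} {y₀ : F}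
    (hy : y₀ ∈ (extChartAt I z₀).target)
    (hf : ContMDiffAt I 𝓘(ℝ, V) ∞ f ((extChartAt I z₀).symm y₀)) :
    (pullTo I f θ).inChart z₀ =ᶠ[𝓝 y₀] fun y =>
      (θ ((f ∘ (extChartAt I z₀).symm) y)).compContinuousLinearMap
        (fderiv ℝ (f ∘ (extChartAt I z₀).symm) y) := by
  have hψ := contMDiffAt_extChartAt_symm (I := I) hy
  have hd : ∀ᶠ y in 𝓝 y₀, ContMDiffAt I 𝓘(ℝ, V) 1 f ((extChartAt I z₀).symm y) :=
    hψ.continuousAt.eventually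
      ((contMDiffAt_iff_contMDiffAt_nhds (by simp)).1 (hf.of_le (by simp)))
  filter_upwards [hd, extChartAt_target_mem_nhds_of_mem hy] with y hfy hyt
  ext v
  refine congrArg (θ (f ((extChartAt I z₀).symm y))) (funext fun i => ?_)
  have := mfderiv_comp y (hfy.mdifferentiableAt (by simp))
    ((contMDiffAt_extChartAt_symm hyt).mdifferentiableAt (by simp))
  rw [mfderiv_eq_fderiv] at this
  exact (DFunLike.congr_fun this (v i)).symm

/-- A form that is locally a pull-back of smooth forms on a vector space is smooth. -/
theorem isSmooth_of_pullTo {α : DiffForm I P k}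
    (h : ∀ z : P, ∃ (f : P → V) (θ : V → V [⋀^Fin k]→L[ℝ] ℝ), ContMDiffAt I 𝓘(ℝ, V) ∞ f z ∧
      ContDiff ℝ ∞ θ ∧ ∀ᶠ x in 𝓝 z, α x = pullTo I f θ x) : α.IsSmooth := by
  intro z₀ y₀ hy
  obtain ⟨f, θ, hf, hθ, he⟩ := h ((extChartAt I z₀).symm y₀)
  have hψ := contMDiffAt_extChartAt_symm (I := I) hy
  refine ContDiffAt.contDiffWithinAt ?_
  refine ContDiffAt.congr_of_eventuallyEq ?_
    ((inChart_congr hψ.continuousAt he).trans (pull_pullTo_eventuallyEq θ hy hf))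
  have hc : ContDiffAt ℝ ∞ (f ∘ (extChartAt I z₀).symm) y₀ := (hf.comp y₀ hψ).contDiffAt
  exact ContDiffAt.continuousAlternatingMapComp (hθ.contDiffAt.comp y₀ hc)
    (hc.fderiv_right (by simp))

/-- The chart at `z` enters through its inverse in `inChart` and directly in `d`; by the chain rule
the two derivatives cancel. This is how Ω is computed from the coordinate expression of Θ. -/
theorem d_eq_pullTo {α : DiffForm I P k} {z : P} {f : P → V} {θ : V → V [⋀^Fin k]→L[ℝ] ℝ}
    (hf : ContMDiffAt I 𝓘(ℝ, V) ∞ f z) (hθ : ContDiff ℝ ∞ θ)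
    (he : ∀ᶠ x in 𝓝 z, α x = pullTo I f θ x) : α.d z = pullTo I f (extDeriv θ) z := by
  have hy := mem_extChartAt_target (I := I) z
  have hψ := contMDiffAt_extChartAt_symm (I := I) hy
  have hl : (extChartAt I z).symm (extChartAt I z z) = z := extChartAt_to_inv z
  have hf' : ContMDiffAt I 𝓘(ℝ, V) ∞ f ((extChartAt I z).symm (extChartAt I z z)) := by rwa [hl]
  have hc : ContDiffAt ℝ ∞ (f ∘ (extChartAt I z).symm) (extChartAt I z z) :=
    (hf'.comp _ hψ).contDiffAt
  have h1 := (inChart_congr hψ.continuousAt (by rwa [hl])).trans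
    (pull_pullTo_eventuallyEq θ hy hf')
  ext v
  change extDeriv (α.inChart z) _ _ = _
  rw [h1.extDeriv_eq, extDeriv_pullback (r := ∞) (hθ.differentiable (by simp) _) hc
    minSmoothness_two_le_infty]
  change extDeriv θ (f ((extChartAt I z).symm (extChartAt I z z))) _ = extDeriv θ (f z) _
  rw [hl]
  refine congrArg (extDeriv θ (f z)) (funext fun i => ?_)
  have hφ : MDifferentiableAt I 𝓘(ℝ, F) (extChartAt I z) z :=
    mdifferentiableAt_extChartAt (mem_chart_source H z)
  have h2 := mfderiv_comp z (hc.differentiableAt (by simp)).mdifferentiableAt hφ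
  rw [mfderiv_eq_fderiv] at h2
  have h3 : mfderiv I 𝓘(ℝ, V) ((f ∘ (extChartAt I z).symm) ∘ extChartAt I z) z =
      mfderiv I 𝓘(ℝ, V) f z := by
    refine Filter.EventuallyEq.mfderiv_eq ?_
    filter_upwards [extChartAt_source_mem_nhds (I := I) z] with x hx
    exact congrArg f ((extChartAt I z).left_inv hx)
  exact (DFunLike.congr_fun (h2.symm.trans h3) (v i))

end DiffForm
end ManifoldForms

/-! ### Smoothness of the contraction with a vector field. -/

section Contraction

variable {F H P : Type*} [NormedAddCommGroup F] [NormedSpace ℝ F] [TopologicalSpace H]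
  [TopologicalSpace P] [ChartedSpace H P] {I : ModelWithCorners ℝ F H} {k : ℕ}
  [I.Boundaryless] [IsManifold I ∞ P]

namespace DiffForm

theorem mfderiv_extChartAt_symm_comp {z₀ : P} {y : F} (hy : y ∈ (extChartAt I z₀).target)
    (v : TangentSpace I ((extChartAt I z₀).symm y)) :
    mfderiv 𝓘(ℝ, F) I (extChartAt I z₀).symm y
      (mfderiv I 𝓘(ℝ, F) (extChartAt I z₀) ((extChartAt I z₀).symm y) v) = v := by
  have hz : (extChartAt I z₀).symm y ∈ (extChartAt I z₀).source := (extChartAt I z₀).map_target hy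
  have hr : extChartAt I z₀ ((extChartAt I z₀).symm y) = y := (extChartAt I z₀).right_inv hy
  have h := mfderivWithin_extChartAt_symm_comp_mfderiv_extChartAt' (I := I) (x := z₀) hz
  rw [I.range_eq_univ, mfderivWithin_univ, hr] at h
  exact DFunLike.congr_fun h v

/-- In a chart, the contraction inserts the components of `X` into the first slot of the expression
of `α`. The components are read off by the tangent bundle trivialization, whose fibre map is the
derivative of the chart; the derivative of the inverse chart turns them back into `X`. -/
theorem IsSmooth.contract {α : DiffForm I P (k + 1)} (hα : α.IsSmooth)
    {X : ∀ z : P, TangentSpace I z}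
    (hX : ContMDiff I I.tangent ∞ (fun z => (⟨z, X z⟩ : TangentBundle I P))) :
    (α.contract X).IsSmooth := by
  intro z₀ y₀ hy₀
  have hψ := contMDiffAt_extChartAt_symm (I := I) hy₀
  have h1 : ContMDiffAt 𝓘(ℝ, F) 𝓘(ℝ, F) ∞ (fun y => (trivializationAt F (TangentSpace I) z₀
      (⟨(extChartAt I z₀).symm y, X ((extChartAt I z₀).symm y)⟩ : TangentBundle I P)).2) y₀ := by
    have := ((trivializationAt F (TangentSpace I) z₀).contMDiffOn (IB := I) (n := ∞)).contMDiffAt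
      (x := ⟨(extChartAt I z₀).symm y₀, X ((extChartAt I z₀).symm y₀)⟩)
      ((trivializationAt F (TangentSpace I) z₀).open_source.mem_nhds (by
        rw [Trivialization.mem_source]
        have := (extChartAt I z₀).map_target hy₀
        rwa [extChartAt_source] at this))
    exact contMDiffAt_snd.comp y₀ (this.comp y₀ (hX.contMDiffAt.comp y₀ hψ))
  have h2 : ContDiffAt ℝ ∞ (fun y => (α.inChart z₀ y).curryLeft
      (trivializationAt F (TangentSpace I) z₀
        (⟨(extChartAt I z₀).symm y, X ((extChartAt I z₀).symm y)⟩ : TangentBundle I P)).2) y₀ :=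
    ((hα z₀).contDiffAt (extChartAt_target_mem_nhds_of_mem hy₀)).curryLeft h1.contDiffAt
  refine ContDiffAt.contDiffWithinAt (h2.congr_of_eventuallyEq ?_)
  filter_upwards [extChartAt_target_mem_nhds_of_mem hy₀] with y hy
  ext v
  change α ((extChartAt I z₀).symm y) _ = α ((extChartAt I z₀).symm y) _
  refine congrArg (α _) (funext fun i => ?_)
  refine Fin.cases ?_ (fun j => ?_) i
  · have hz := (extChartAt I z₀).map_target hy
    rw [extChartAt_source] at hz
    have h3 := TangentBundle.continuousLinearMapAt_trivializationAt (I := I) hz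
    have h4 := DFunLike.congr_fun h3 (X ((extChartAt I z₀).symm y))
    rw [Trivialization.continuousLinearMapAt_apply, Trivialization.coe_linearMapAt_of_mem _ hz] at h4
    change X ((extChartAt I z₀).symm y) = mfderiv 𝓘(ℝ, F) I (extChartAt I z₀).symm y _
    exact ((congrArg _ h4).trans (mfderiv_extChartAt_symm_comp hy _)).symm
  · rfl

end DiffForm
end Contraction

/-! ### Differentiation under the integral sign. -/

section ParametricIntegral

universe u

theorem continuous_slice {X Y : Type*} [TopologicalSpace X] [TopologicalSpace Y] {U : Set Y}
    {f : ℝ × Y → X} (hf : ContinuousOn f (univ ×ˢ U)) {y : Y} (hy : y ∈ U) :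
    Continuous fun r : ℝ => f (r, y) :=
  continuousOn_univ.1 <| hf.comp (by fun_prop) fun _ _ => ⟨mem_univ _, hy⟩

variable {F : Type u} [NormedAddCommGroup F] [NormedSpace ℝ F]

theorem hasFDerivAt_intervalIntegral_of_contDiffOn {G : Type*} [NormedAddCommGroup G]
    [NormedSpace ℝ G] {U : Set F} (hU : IsOpen U) {f : ℝ × F → G}
    (hf : ContDiffOn ℝ 1 f (univ ×ˢ U)) {y₀ : F} (hy₀ : y₀ ∈ U) :
    HasFDerivAt (fun y => ∫ r in (0 : ℝ)..1, f (r, y))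
      (∫ r in (0 : ℝ)..1, (fderiv ℝ f (r, y₀)).comp (ContinuousLinearMap.inr ℝ ℝ F)) y₀ := by
  have hO : IsOpen ((univ : Set ℝ) ×ˢ U) := isOpen_univ.prod hU
  have hd : ContinuousOn (fun x => (fderiv ℝ f x).comp (ContinuousLinearMap.inr ℝ ℝ F))
      (univ ×ˢ U) :=
    (hf.continuousOn_fderiv_of_isOpen hO le_rfl).clm_comp continuousOn_const
  obtain ⟨C, hC⟩ : ∃ C : ℝ, ∀ r ∈ Icc (0 : ℝ) 1,
      ‖(fderiv ℝ f (r, y₀)).comp (ContinuousLinearMap.inr ℝ ℝ F)‖ ≤ C :=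
    isCompact_Icc.exists_bound_of_continuousOn (continuous_slice hd hy₀).continuousOn
  -- Compactness of `[0, 1]` gives one neighbourhood of `y₀` that works for all `r`, so the constant
  -- `C + 1` is a dominating function there.
  have hb : ∀ᶠ y in 𝓝 y₀, ∀ r ∈ Icc (0 : ℝ) 1,
      ‖(fderiv ℝ f (r, y)).comp (ContinuousLinearMap.inr ℝ ℝ F)‖ < C + 1 := by
    refine (isCompact_Icc).eventually_forall_of_forall_eventually fun r hr => ?_
    have hc : ContinuousAt (fun x : F × ℝ =>
        ‖(fderiv ℝ f (x.2, x.1)).comp (ContinuousLinearMap.inr ℝ ℝ F)‖) (y₀, r) :=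
      ((hd.continuousAt (hO.mem_nhds ⟨mem_univ r, hy₀⟩)).comp
        (f := fun x : F × ℝ => (x.2, x.1)) (x := (y₀, r)) (by fun_prop)).norm
    exact hc.eventually (gt_mem_nhds (lt_of_le_of_lt (hC r hr) (by linarith)))
  have hs := hb.and (hU.mem_nhds hy₀)
  refine (intervalIntegral.hasFDerivAt_integral_of_dominated_of_fderiv_le (s := {y | _})
    (F' := fun y r => (fderiv ℝ f (r, y)).comp (ContinuousLinearMap.inr ℝ ℝ F))
    (bound := fun _ => C + 1) hs ?_ ?_ ?_ ?_ ?_ ?_)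
  · filter_upwards [hU.mem_nhds hy₀] with y hy
    exact (continuous_slice hf.continuousOn hy).aestronglyMeasurable
  · exact (continuous_slice hf.continuousOn hy₀).intervalIntegrable _ _
  · exact (continuous_slice hd hy₀).aestronglyMeasurable
  · refine Filter.Eventually.of_forall fun r hr y hy => (hy.1 r ?_).le
    rw [uIoc_of_le zero_le_one] at hr
    exact Ioc_subset_Icc_self hr
  · exact intervalIntegrable_const
  · refine Filter.Eventually.of_forall fun r _ y hy => ?_
    have h1 : HasFDerivAt f (fderiv ℝ f (r, y)) (r, y) :=
      ((hf.contDiffAt (hO.mem_nhds (mk_mem_prod (mem_univ r) hy.2))).differentiableAt (by simp)).hasFDerivAt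
    exact h1.comp y (hasFDerivAt_prodMk_right r y)

/-- Induction on `n`, applied to the partial derivative in `y`. The target `G` varies in the
induction, since derivatives take values in `F →L[ℝ] G`; a common universe for `F` and `G` keeps
these targets within its range. The one order of smoothness lost is harmless for the `C^∞`
conclusion. -/
theorem contDiffOn_intervalIntegral_nat (n : ℕ) {U : Set F} (hU : IsOpen U) :
    ∀ {G : Type u} [NormedAddCommGroup G] [NormedSpace ℝ G] {f : ℝ × F → G},
      ContDiffOn ℝ (n + 1) f (univ ×ˢ U) →
      ContDiffOn ℝ n (fun y => ∫ r in (0 : ℝ)..1, f (r, y)) U := by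
  have hO : IsOpen ((univ : Set ℝ) ×ˢ U) := isOpen_univ.prod hU
  induction n with
  | zero =>
    intro G _ _ f hf
    refine contDiffOn_zero.2 fun y hy => ContinuousAt.continuousWithinAt ?_
    exact (hasFDerivAt_intervalIntegral_of_contDiffOn hU (hf.of_le (by simp)) hy).continuousAt
  | succ n ih =>
    intro G _ _ f hf
    have h1 : ∀ y ∈ U, HasFDerivAt _ _ y := fun y hy =>
      hasFDerivAt_intervalIntegral_of_contDiffOn hU (hf.of_le (by simp)) hy
    rw [Nat.cast_add, Nat.cast_one, contDiffOn_succ_iff_fderiv_of_isOpen hU]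
    refine ⟨fun y hy => (h1 y hy).differentiableAt.differentiableWithinAt, by simp, ?_⟩
    refine ContDiffOn.congr ?_ fun y hy => (h1 y hy).fderiv
    exact ih (f := fun x => (fderiv ℝ f x).comp (ContinuousLinearMap.inr ℝ ℝ F))
      ((hf.fderiv_of_isOpen hO (by simp)).clm_comp contDiffOn_const)

theorem contDiffOn_intervalIntegral {U : Set F} (hU : IsOpen U)
    {G : Type u} [NormedAddCommGroup G] [NormedSpace ℝ G] {f : ℝ × F → G}
    (hf : ContDiffOn ℝ ∞ f (univ ×ˢ U)) :
    ContDiffOn ℝ ∞ (fun y => ∫ r in (0 : ℝ)..1, f (r, y)) U :=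
  contDiffOn_infty.2 fun n => contDiffOn_intervalIntegral_nat n hU
    (by exact_mod_cast contDiffOn_infty.1 hf (n + 1))

end ParametricIntegral

/-! ### The homotopy operator and the homotopy formula. -/

section Homotopy

universe u

variable {F : Type u} [NormedAddCommGroup F] [NormedSpace ℝ F] {k : ℕ}

/-- Pull-back along the inclusion `F → ℝ × F` of a time slice. -/
def sliceCLM (F : Type u) [NormedAddCommGroup F] [NormedSpace ℝ F] (k : ℕ) :
    ((ℝ × F) [⋀^Fin k]→L[ℝ] ℝ) →L[ℝ] F [⋀^Fin k]→L[ℝ] ℝ :=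
  ContinuousAlternatingMap.compContinuousLinearMapCLM (ContinuousLinearMap.inr ℝ ℝ F)

/-- Contraction with `∂ᵣ` followed by restriction to a time slice. -/
def fibreContraction (F : Type u) [NormedAddCommGroup F] [NormedSpace ℝ F] (k : ℕ) :
    ((ℝ × F) [⋀^Fin (k + 1)]→L[ℝ] ℝ) →L[ℝ] F [⋀^Fin k]→L[ℝ] ℝ :=
  (sliceCLM F k).comp
    ((ContinuousLinearMap.apply ℝ ((ℝ × F) [⋀^Fin k]→L[ℝ] ℝ) ((1 : ℝ), (0 : F))).comp
      ContinuousAlternatingMap.curryLeftLI.toContinuousLinearMap)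

theorem sliceCLM_apply (w : (ℝ × F) [⋀^Fin k]→L[ℝ] ℝ) (v : Fin k → F) :
    sliceCLM F k w v = w (fun i => (0, v i)) := rfl

/-- This is Cartan's formula at a point, with `A` the derivative of a form. Evaluate the vanishing
alternatization on `(∂ᵣ, v₀, …, v_k)`: the first term is the `r`-derivative of the form, and the
other terms, with signs shifted by one position, are minus the exterior derivative of the
contraction. -/
theorem alternatizeUncurryFin_fibreContraction
    (A : (ℝ × F) →L[ℝ] (ℝ × F) [⋀^Fin (k + 1)]→L[ℝ] ℝ)
    (hA : ContinuousAlternatingMap.alternatizeUncurryFin A = 0) :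
    ContinuousAlternatingMap.alternatizeUncurryFin
      (((fibreContraction F k).comp A).comp (ContinuousLinearMap.inr ℝ ℝ F)) =
      sliceCLM F (k + 1) (A (1, 0)) := by
  ext v
  have h : ContinuousAlternatingMap.alternatizeUncurryFin A
      (Fin.cons ((1 : ℝ), (0 : F)) (fun i => ((0 : ℝ), v i)) : Fin (k + 2) → ℝ × F) = (0 : ℝ) :=
    DFunLike.congr_fun hA _
  rw [ContinuousAlternatingMap.alternatizeUncurryFin_apply, Fin.sum_univ_succ] at h
  rw [ContinuousAlternatingMap.alternatizeUncurryFin_apply, sliceCLM_apply]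
  simp only [Fin.val_zero, pow_zero, one_smul, Fin.cons_zero, Fin.removeNth_zero, Fin.tail_cons,
    Fin.val_succ, Fin.cons_succ] at h
  rw [add_eq_zero_iff_eq_neg] at h
  rw [h, ← Finset.sum_neg_distrib]
  refine Finset.sum_congr rfl fun i _ => ?_
  rw [pow_succ, mul_neg_one, neg_smul, neg_neg]
  congr 1
  change (A (0, v i)) _ = (A (0, v i)) _
  refine congrArg (A (0, v i)) ?_
  funext j
  refine Fin.cases ?_ (fun j => ?_) j
  · simp [Fin.removeNth]
  · simp [Fin.removeNth]

theorem contDiffOn_integral_fibreContraction {U : Set F} (hU : IsOpen U)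
    {W : ℝ × F → (ℝ × F) [⋀^Fin (k + 1)]→L[ℝ] ℝ} (hW : ContDiffOn ℝ ∞ W (univ ×ˢ U)) :
    ContDiffOn ℝ ∞ (fun y => ∫ r in (0 : ℝ)..1, fibreContraction F k (W (r, y))) U :=
  contDiffOn_intervalIntegral hU (f := fun x => fibreContraction F k (W x))
    ((fibreContraction F k).contDiff.comp_contDiffOn hW)

/-- After `extDeriv` is moved under the integral, the pointwise Cartan identity makes the integrand
the `r`-derivative of the slice restriction, and the fundamental theorem of calculus leaves the two
endpoints. -/
theorem extDeriv_integral_fibreContraction {U : Set F} (hU : IsOpen U)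
    {W : ℝ × F → (ℝ × F) [⋀^Fin (k + 1)]→L[ℝ] ℝ} (hW : ContDiffOn ℝ ∞ W (univ ×ˢ U))
    (hc : ∀ x ∈ univ ×ˢ U, extDeriv W x = 0) {y : F} (hy : y ∈ U) :
    extDeriv (fun y => ∫ r in (0 : ℝ)..1, fibreContraction F k (W (r, y))) y =
      sliceCLM F (k + 1) (W (1, y)) - sliceCLM F (k + 1) (W (0, y)) := by
  have hO : IsOpen ((univ : Set ℝ) ×ˢ U) := isOpen_univ.prod hU
  have hf : ContDiffOn ℝ ∞ (fun x => fibreContraction F k (W x)) (univ ×ˢ U) :=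
    (fibreContraction F k).contDiff.comp_contDiffOn hW
  have hd := hasFDerivAt_intervalIntegral_of_contDiffOn hU (hf.of_le (by simp)) hy
  have hdW : ∀ r, DifferentiableAt ℝ W (r, y) := fun r =>
    (hW.contDiffAt (hO.mem_nhds ⟨mem_univ r, hy⟩)).differentiableAt (by simp)
  have hfd : ∀ r, fderiv ℝ (fun x => fibreContraction F k (W x)) (r, y) =
      (fibreContraction F k).comp (fderiv ℝ W (r, y)) := fun r =>
    ((fibreContraction F k).hasFDerivAt.comp (r, y) (hdW r).hasFDerivAt).fderiv
  have hcW : Continuous fun r : ℝ => fderiv ℝ W (r, y) :=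
    continuous_slice (hW.continuousOn_fderiv_of_isOpen hO (by simp)) hy
  have hcont : Continuous fun r : ℝ =>
      (fderiv ℝ (fun x => fibreContraction F k (W x)) (r, y)).comp
        (ContinuousLinearMap.inr ℝ ℝ F) := by
    simp only [hfd]
    fun_prop
  rw [extDeriv, hd.fderiv]
  let T : (F →L[ℝ] F [⋀^Fin k]→L[ℝ] ℝ) →L[ℝ] F [⋀^Fin (k + 1)]→L[ℝ] ℝ :=
    ContinuousAlternatingMap.alternatizeUncurryFinCLM ℝ F ℝ
  refine (ContinuousLinearMap.intervalIntegral_comp_comm (𝕜 := ℝ) (E := F →L[ℝ] F [⋀^Fin k]→L[ℝ] ℝ)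
    (F := F [⋀^Fin (k + 1)]→L[ℝ] ℝ) (μ := MeasureTheory.volume) T
    (Continuous.intervalIntegrable (E := F →L[ℝ] F [⋀^Fin k]→L[ℝ] ℝ) hcont 0 1)).symm.trans ?_
  have h1 : ∀ r : ℝ, T ((fderiv ℝ (fun x => fibreContraction F k (W x)) (r, y)).comp
        (ContinuousLinearMap.inr ℝ ℝ F)) = sliceCLM F (k + 1) (fderiv ℝ W (r, y) (1, 0)) := by
    intro r
    rw [hfd]
    exact alternatizeUncurryFin_fibreContraction _ (hc (r, y) ⟨mem_univ r, hy⟩)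
  simp only [h1]
  refine intervalIntegral.integral_eq_sub_of_hasDerivAt
    (f := fun r => sliceCLM F (k + 1) (W (r, y))) (fun r _ => ?_) ?_
  · have h2 : HasDerivAt (fun r : ℝ => (r, y)) ((1 : ℝ), (0 : F)) r :=
      (hasDerivAt_id r).prodMk (hasDerivAt_const r y)
    exact (sliceCLM F (k + 1)).hasFDerivAt.comp_hasDerivAt r
      ((hdW r).hasFDerivAt.comp_hasDerivAt r h2)
  · exact Continuous.intervalIntegrable (by fun_prop) 0 1

variable {H P : Type*} [TopologicalSpace H]
  [TopologicalSpace P] [ChartedSpace H P] {I : ModelWithCorners ℝ F H}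

namespace DiffForm

/-- The pull-back of a form along a self-map of a manifold. -/
def pullback (g : P → P) (α : DiffForm I P k) : DiffForm I P k := fun z =>
  (α (g z)).compContinuousLinearMap (mfderiv I I g z)

theorem pullback_id (α : DiffForm I P k) : α.pullback (fun z => z) = α := by
  funext z
  ext v
  refine congrArg (α z) (funext fun i => ?_)
  exact DFunLike.congr_fun (mfderiv_id (I := I) (x := z)) (v i)

/-- The form `ι_{∂ᵣ} G*α` on the slice `{r} × P`. -/
def homotopyIntegrand (G : ℝ × P → P) (α : DiffForm I P (k + 1)) (z : P) (r : ℝ) :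
    F [⋀^Fin k]→L[ℝ] ℝ :=
  fibreContraction F k ((α (G (r, z))).compContinuousLinearMap
    (mfderiv (𝓘(ℝ, ℝ).prod I) I G (r, z) : ℝ × F →L[ℝ] F))

/-- The homotopy operator `∫₀¹ ι_{∂ᵣ} G*α dr` of a smooth homotopy `G`. -/
def homotopyOperator (G : ℝ × P → P) (α : DiffForm I P (k + 1)) : DiffForm I P k := fun z =>
  (∫ r in (0 : ℝ)..1, homotopyIntegrand G α z r : F [⋀^Fin k]→L[ℝ] ℝ)

variable [I.Boundaryless] [IsManifold I ∞ P]

theorem hasMFDerivAt_prodMk_extChartAt_symm {z₀ : P} {y : F}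
    (hy : y ∈ (extChartAt I z₀).target) (r : ℝ) :
    HasMFDerivAt 𝓘(ℝ, ℝ × F) (𝓘(ℝ, ℝ).prod I)
      (fun x : ℝ × F => (x.1, (extChartAt I z₀).symm x.2)) (r, y)
      ((ContinuousLinearMap.fst ℝ ℝ F).prod
        ((mfderiv 𝓘(ℝ, F) I (extChartAt I z₀).symm y).comp (ContinuousLinearMap.snd ℝ ℝ F))) := by
  refine HasMFDerivAt.prodMk hasFDerivAt_fst.hasMFDerivAt ?_
  refine HasMFDerivAt.comp (r, y) ?_ hasFDerivAt_snd.hasMFDerivAt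
  exact ((contMDiffAt_extChartAt_symm hy).mdifferentiableAt (by simp)).hasMFDerivAt

theorem contMDiffAt_homotopy_chart {G : ℝ × P → P} (hG : ContMDiff (𝓘(ℝ, ℝ).prod I) I ∞ G)
    {z₀ : P} {y : F} (hy : y ∈ (extChartAt I z₀).target) (r : ℝ) :
    ContMDiffAt 𝓘(ℝ, ℝ × F) I ∞
      (fun x : ℝ × F => G (x.1, (extChartAt I z₀).symm x.2)) (r, y) := by
  refine hG.contMDiffAt.comp (r, y) (ContMDiffAt.prodMk contDiff_fst.contMDiff.contMDiffAt ?_)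
  exact (contMDiffAt_extChartAt_symm hy).comp (r, y) contDiff_snd.contMDiff.contMDiffAt

theorem homotopyIntegrand_comp (α : DiffForm I P (k + 1)) {G : ℝ × P → P}
    (hG : ContMDiff (𝓘(ℝ, ℝ).prod I) I ∞ G) {z₀ : P} {y : F}
    (hy : y ∈ (extChartAt I z₀).target) (r : ℝ) :
    (homotopyIntegrand G α ((extChartAt I z₀).symm y) r).compContinuousLinearMap
      (mfderiv 𝓘(ℝ, F) I (extChartAt I z₀).symm y) =
    fibreContraction F k
      (α.pull (fun x : ℝ × F => G (x.1, (extChartAt I z₀).symm x.2)) (r, y)) := by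
  have h := ((hG.contMDiffAt.mdifferentiableAt (by simp)).hasMFDerivAt.comp (r, y)
    (hasMFDerivAt_prodMk_extChartAt_symm (I := I) hy r)).mfderiv
  ext v
  refine congrArg (α (G (r, (extChartAt I z₀).symm y))) (funext fun i => ?_)
  refine Eq.trans ?_ (DFunLike.congr_fun h _).symm
  refine Fin.cases ?_ (fun j => ?_) i
  -- The slot of `∂ᵣ` holds `(1, 0)`, and its second component stays `0` under the derivative of the
  -- inverse chart.
  · exact congrArg (fun w : F => (mfderiv (𝓘(ℝ, ℝ).prod I) I G
      (r, (extChartAt I z₀).symm y) : ℝ × F →L[ℝ] F) ((1 : ℝ), w))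
      (map_zero (mfderiv 𝓘(ℝ, F) I (extChartAt I z₀).symm y)).symm
  · rfl

theorem contDiffOn_pull_homotopy {α : DiffForm I P (k + 1)} (hα : α.IsSmooth)
    {G : ℝ × P → P} (hG : ContMDiff (𝓘(ℝ, ℝ).prod I) I ∞ G) (z₀ : P) :
    ContDiffOn ℝ ∞ (α.pull (fun x : ℝ × F => G (x.1, (extChartAt I z₀).symm x.2)))
      (univ ×ˢ (extChartAt I z₀).target) := fun x hx =>
  (hα.contDiffAt_pull (contMDiffAt_homotopy_chart hG hx.2 x.1)).contDiffWithinAt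

theorem continuous_homotopyIntegrand {α : DiffForm I P (k + 1)} (hα : α.IsSmooth)
    {G : ℝ × P → P} (hG : ContMDiff (𝓘(ℝ, ℝ).prod I) I ∞ G) {z₀ : P} {y : F}
    (hy : y ∈ (extChartAt I z₀).target) :
    Continuous (homotopyIntegrand G α ((extChartAt I z₀).symm y)) := by
  have h1 := (fibreContraction F k).continuous.comp
    (continuous_slice (contDiffOn_pull_homotopy hα hG z₀).continuousOn hy)
  let A : F →L[ℝ] F := mfderiv I 𝓘(ℝ, F) (extChartAt I z₀) ((extChartAt I z₀).symm y)
  have h2 := (ContinuousAlternatingMap.compContinuousLinearMapCLM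
    (F := ℝ) (ι := Fin k) A).continuous.comp h1
  refine h2.congr fun r => ?_
  change (fibreContraction F k
    (α.pull (fun x : ℝ × F => G (x.1, (extChartAt I z₀).symm x.2)) (r, y))).compContinuousLinearMap
      A = _
  rw [← homotopyIntegrand_comp α hG hy r]
  ext v
  refine congrArg (homotopyIntegrand G α ((extChartAt I z₀).symm y) r) (funext fun i => ?_)
  exact mfderiv_extChartAt_symm_comp hy (v i)

/-- Only the source point is put in a chart: the curve `r ↦ G (r, z)` may leave every single chart,
and `pull` along a map from `ℝ × F` into `P` accommodates this. The operator thereby reduces to the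
integral over a vector space. -/
theorem inChart_homotopyOperator {α : DiffForm I P (k + 1)} (hα : α.IsSmooth)
    {G : ℝ × P → P} (hG : ContMDiff (𝓘(ℝ, ℝ).prod I) I ∞ G) {z₀ : P} {y : F}
    (hy : y ∈ (extChartAt I z₀).target) :
    (homotopyOperator G α).inChart z₀ y = ∫ r in (0 : ℝ)..1, fibreContraction F k
      (α.pull (fun x : ℝ × F => G (x.1, (extChartAt I z₀).symm x.2)) (r, y)) := by
  simp only [← homotopyIntegrand_comp α hG hy]
  let A : F →L[ℝ] F := mfderiv 𝓘(ℝ, F) I (extChartAt I z₀).symm y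
  let T : (F [⋀^Fin k]→L[ℝ] ℝ) →L[ℝ] F [⋀^Fin k]→L[ℝ] ℝ :=
    ContinuousAlternatingMap.compContinuousLinearMapCLM A
  exact (T.intervalIntegral_comp_comm
    ((continuous_homotopyIntegrand hα hG hy).intervalIntegrable 0 1)).symm

theorem isSmooth_homotopyOperator {α : DiffForm I P (k + 1)} (hα : α.IsSmooth)
    {G : ℝ × P → P} (hG : ContMDiff (𝓘(ℝ, ℝ).prod I) I ∞ G) :
    (homotopyOperator G α).IsSmooth := fun z₀ =>
  (contDiffOn_integral_fibreContraction (isOpen_extChartAt_target z₀)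
    (contDiffOn_pull_homotopy hα hG z₀)).congr fun _ hy => inChart_homotopyOperator hα hG hy

theorem sliceCLM_pull_comp (α : DiffForm I P k) {G : ℝ × P → P}
    (hG : ContMDiff (𝓘(ℝ, ℝ).prod I) I ∞ G) (z : P) (r : ℝ) :
    (sliceCLM F k (α.pull (fun x : ℝ × F => G (x.1, (extChartAt I z).symm x.2))
      (r, extChartAt I z z))).compContinuousLinearMap (mfderiv I 𝓘(ℝ, F) (extChartAt I z) z) =
    α.pullback (fun x => G (r, x)) z := by
  have hy := mem_extChartAt_target (I := I) z
  have h1 := ((contMDiffAt_homotopy_chart hG hy r).mdifferentiableAt (by simp)).hasMFDerivAt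
  have h2 : HasMFDerivAt I 𝓘(ℝ, ℝ × F) (fun x => (r, extChartAt I z x)) z
      ((ContinuousLinearMap.inr ℝ ℝ F).comp (mfderiv I 𝓘(ℝ, F) (extChartAt I z) z)) :=
    HasMFDerivAt.comp z (hasFDerivAt_prodMk_right r (extChartAt I z z)).hasMFDerivAt
      (mdifferentiableAt_extChartAt (mem_chart_source H z)).hasMFDerivAt
  have h3 := (HasMFDerivAt.comp z h1 h2).congr_of_eventuallyEq (f₁ := fun x => G (r, x)) (by
    filter_upwards [extChartAt_source_mem_nhds (I := I) z] with x hx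
    exact congrArg (fun w => G (r, w)) ((extChartAt I z).left_inv hx).symm)
  ext v
  change α (G (r, (extChartAt I z).symm (extChartAt I z z))) _ = α (G (r, z)) _
  rw [extChartAt_to_inv]
  refine congrArg (α (G (r, z))) (funext fun i => ?_)
  exact (DFunLike.congr_fun h3.mfderiv (v i)).symm

/-- Homotopy formula for closed forms. -/
theorem IsClosed.d_homotopyOperator {α : DiffForm I P (k + 1)} (hc : α.IsClosed)
    (hα : α.IsSmooth) {G : ℝ × P → P} (hG : ContMDiff (𝓘(ℝ, ℝ).prod I) I ∞ G) :
    (homotopyOperator G α).d =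
      α.pullback (fun x => G (1, x)) - α.pullback (fun x => G (0, x)) := by
  funext z
  have hy := mem_extChartAt_target (I := I) z
  have h0 : ∀ x ∈ univ ×ˢ (extChartAt I z).target,
      extDeriv (α.pull (fun x : ℝ × F => G (x.1, (extChartAt I z).symm x.2))) x = 0 := by
    intro x hx
    rw [hα.extDeriv_pull (contMDiffAt_homotopy_chart hG hx.2 x.1), hc]
    rfl
  have h1 : (homotopyOperator G α).inChart z =ᶠ[𝓝 (extChartAt I z z)] fun y =>
      ∫ r in (0 : ℝ)..1, fibreContraction F k
        (α.pull (fun x : ℝ × F => G (x.1, (extChartAt I z).symm x.2)) (r, y)) := by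
    filter_upwards [extChartAt_target_mem_nhds_of_mem hy] with y hy'
    exact inChart_homotopyOperator hα hG hy'
  rw [DiffForm.d, h1.extDeriv_eq, extDeriv_integral_fibreContraction
    (isOpen_extChartAt_target z) (contDiffOn_pull_homotopy hα hG z) h0 hy, Pi.sub_apply,
    ← sliceCLM_pull_comp α hG, ← sliceCLM_pull_comp α hG]
  rfl

end DiffForm

end Homotopy

/-! ### A smooth cut-off of the time variable. -/

section SmoothClamp

/-- A smooth function that is the identity on `(-∞, a]` and maps `[a, ∞)` into `[a, b)`. -/
theorem exists_smooth_clamp {a b : ℝ} (hab : a < b) :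
    ∃ ρ : ℝ → ℝ, ContDiff ℝ ∞ ρ ∧ (∀ s ≤ a, ρ s = s) ∧ ∀ s, a ≤ s → ρ s ∈ Ico a b := by
  let c := (a + b) / 2
  have hac : a < c := by simp only [c]; linarith
  have hcb : c < b := by simp only [c]; linarith
  let χ : ℝ → ℝ := fun s => Real.smoothTransition ((s - a) / (c - a))
  have hχ : ContDiff ℝ ∞ χ := Real.smoothTransition.contDiff.comp (by fun_prop)
  -- The map interpolates from `s` to the constant midpoint `c`: `χ` vanishes up to `a` and equals
  -- `1` from `c` on, and a convex combination of `s` and `c` stays in `[a, c]` in between.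
  refine ⟨fun s => s + χ s * (c - s), by fun_prop, fun s hs => ?_, fun s hs => ?_⟩
  · have : χ s = 0 := Real.smoothTransition.zero_of_nonpos
      (div_nonpos_of_nonpos_of_nonneg (by linarith) (by linarith))
    simp [this]
  · have h0 : 0 ≤ χ s := Real.smoothTransition.nonneg _
    have h1 : χ s ≤ 1 := Real.smoothTransition.le_one _
    rcases le_total s c with h | h
    · constructor <;> dsimp only <;> nlinarith
    · have : χ s = 1 := Real.smoothTransition.one_of_one_le
        ((one_le_div (by linarith)).2 (by linarith))
      simp only [this, one_mul, add_sub_cancel]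
      exact ⟨hac.le, hcb⟩

end SmoothClamp

/-! ### Triviality of smooth bundles over the real line. -/

section Trivializations

variable {E M Q : Type*} [NormedAddCommGroup E] [NormedSpace ℝ E]
  [TopologicalSpace M] [ChartedSpace E M] [TopologicalSpace Q] [ChartedSpace (ℝ × E) Q]

/-- A smooth product structure `q ↦ (t q, f q)`, with inverse `g`, on the part of `Q` over `U`. -/
structure IsProductOver (t : Q → ℝ) (U : Set ℝ) (f : Q → M) (g : ℝ × M → Q) : Prop where
  contMDiffOn_fst : ContMDiffOn 𝓘(ℝ, ℝ × E) 𝓘(ℝ, E) ∞ f (t ⁻¹' U)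
  contMDiffOn_symm : ContMDiffOn (𝓘(ℝ, ℝ).prod 𝓘(ℝ, E)) 𝓘(ℝ, ℝ × E) ∞ g (U ×ˢ univ)
  time_symm : ∀ s ∈ U, ∀ m, t (g (s, m)) = s
  apply_symm : ∀ s ∈ U, ∀ m, f (g (s, m)) = m
  symm_apply : ∀ q, t q ∈ U → g (t q, f q) = q

namespace IsProductOver

variable {t : Q → ℝ} {U V : Set ℝ} {f f₁ f₂ : Q → M} {g g₁ g₂ : ℝ × M → Q}

theorem reverse (h : IsProductOver (E := E) t U f g) :
    IsProductOver (E := E) (fun q => -t q) (Neg.neg ⁻¹' U) f (fun x => g (-x.1, x.2)) where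
  contMDiffOn_fst := h.contMDiffOn_fst.mono fun q hq => by simpa using hq
  contMDiffOn_symm := h.contMDiffOn_symm.comp
    (ContMDiffOn.prodMk (contDiff_neg.contMDiff.comp contMDiff_fst).contMDiffOn contMDiffOn_snd)
    fun x hx => ⟨hx.1, mem_univ _⟩
  time_symm s hs m := by
    have := h.time_symm (-s) hs m
    simp [this]
  apply_symm s hs m := h.apply_symm (-s) hs m
  symm_apply q hq := by
    have h1 : t q ∈ U := by simpa using hq
    simpa using h.symm_apply q h1

/-- Two maps that are smooth over open sets of times and agree over the overlap glue. -/
theorem contMDiffOn_of_union (ht : ContMDiff 𝓘(ℝ, ℝ × E) 𝓘(ℝ, ℝ) ∞ t) (hU : IsOpen U)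
    (hV : IsOpen V) (h₁ : ContMDiffOn 𝓘(ℝ, ℝ × E) 𝓘(ℝ, E) ∞ f₁ (t ⁻¹' U))
    (h₂ : ContMDiffOn 𝓘(ℝ, ℝ × E) 𝓘(ℝ, E) ∞ f₂ (t ⁻¹' V)) (e₁ : ∀ q, t q ∈ U → f q = f₁ q)
    (e₂ : ∀ q, t q ∈ V → f q = f₂ q) :
    ContMDiffOn 𝓘(ℝ, ℝ × E) 𝓘(ℝ, E) ∞ f (t ⁻¹' (U ∪ V)) := by
  rw [preimage_union]
  exact (h₁.congr e₁).union_of_isOpen (h₂.congr e₂) (hU.preimage ht.continuous)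
    (hV.preimage ht.continuous)

theorem contMDiffOn_symm_of_union (hU : IsOpen U) (hV : IsOpen V)
    (h₁ : ContMDiffOn (𝓘(ℝ, ℝ).prod 𝓘(ℝ, E)) 𝓘(ℝ, ℝ × E) ∞ g₁ (U ×ˢ univ))
    (h₂ : ContMDiffOn (𝓘(ℝ, ℝ).prod 𝓘(ℝ, E)) 𝓘(ℝ, ℝ × E) ∞ g₂ (V ×ˢ univ))
    (e₁ : ∀ s ∈ U, ∀ m, g (s, m) = g₁ (s, m)) (e₂ : ∀ s ∈ V, ∀ m, g (s, m) = g₂ (s, m)) :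
    ContMDiffOn (𝓘(ℝ, ℝ).prod 𝓘(ℝ, E)) 𝓘(ℝ, ℝ × E) ∞ g ((U ∪ V) ×ˢ univ) := by
  rw [union_prod]
  exact (h₁.congr fun x hx => e₁ x.1 hx.1 x.2).union_of_isOpen
    (h₂.congr fun x hx => e₂ x.1 hx.1 x.2) (hU.prod isOpen_univ) (hV.prod isOpen_univ)

/-- Gluing of product structures, without changing the first one before the time `a`. -/
theorem glue (ht : ContMDiff 𝓘(ℝ, ℝ × E) 𝓘(ℝ, ℝ) ∞ t) (hU : IsOpen U) (hV : IsOpen V)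
    (h₁ : IsProductOver (E := E) t U f₁ g₁) (h₂ : IsProductOver (E := E) t V f₂ g₂)
    {l a b : ℝ} (hla : l < a) (hab : a < b) (hbU : Ioo l b ⊆ U) (hbV : Ioo l b ⊆ V) :
    ∃ (f : Q → M) (g : ℝ × M → Q),
      IsProductOver (E := E) t (U ∩ Iio a ∪ V ∩ Ioi l) f g ∧
      (∀ q, t q < a → f q = f₁ q) ∧ ∀ s < a, ∀ m, g (s, m) = g₁ (s, m) := by
  obtain ⟨ρ, hρ, hρa, hρb⟩ := exists_smooth_clamp hab
  have hρl : ∀ s, l < s → ρ s ∈ Ioo l b := by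
    intro s hs
    rcases le_total s a with h | h
    · rw [hρa s h]; exact ⟨hs, h.trans_lt hab⟩
    · exact ⟨hla.trans_le (hρb s h).1, (hρb s h).2⟩
  -- A point over a late time is carried by the second product structure back to the time `ρ (t q) <
  -- b`, where the first one is defined, and its `M`-coordinate is read there. Up to time `a`
  -- nothing is moved, so `F₂` extends `f₁`; `G₂` is the inverse construction.
  let F₂ : Q → M := fun q => f₁ (g₂ (ρ (t q), f₂ q))
  let G₂ : ℝ × M → Q := fun x => g₂ (x.1, f₂ (g₁ (ρ x.1, x.2)))
  let f : Q → M := fun q => if t q < a then f₁ q else F₂ q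
  let g : ℝ × M → Q := fun x => if x.1 < a then g₁ x else G₂ x
  have ef₁ : ∀ q, t q < a → f q = f₁ q := fun q hq => if_pos hq
  have eg₁ : ∀ s < a, ∀ m, g (s, m) = g₁ (s, m) := fun s hs m => if_pos hs
  have ef₂ : ∀ q, t q ∈ V ∩ Ioi l → f q = F₂ q := by
    intro q hq
    by_cases h : t q < a
    · have : F₂ q = f₁ q := by
        simp only [F₂, hρa _ h.le, h₂.symm_apply q hq.1]
      rw [ef₁ q h, this]
    · exact if_neg h
  have eg₂ : ∀ s ∈ V ∩ Ioi l, ∀ m, g (s, m) = G₂ (s, m) := by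
    intro s hs m
    by_cases h : s < a
    · have hsU : s ∈ U := hbU ⟨hs.2, h.trans hab⟩
      have h3 := h₂.symm_apply (g₁ (s, m)) (by rw [h₁.time_symm s hsU]; exact hs.1)
      rw [h₁.time_symm s hsU] at h3
      have : G₂ (s, m) = g₁ (s, m) := by
        simp only [G₂, hρa _ h.le, h3]
      rw [eg₁ s h, this]
    · exact if_neg h
  have sF₂ : ContMDiffOn 𝓘(ℝ, ℝ × E) 𝓘(ℝ, E) ∞ F₂ (t ⁻¹' (V ∩ Ioi l)) := by
    refine h₁.contMDiffOn_fst.comp (h₂.contMDiffOn_symm.comp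
      (ContMDiffOn.prodMk (hρ.contMDiff.comp ht).contMDiffOn
        (h₂.contMDiffOn_fst.mono fun q hq => hq.1)) ?_) ?_
    · exact fun q hq => ⟨hbV (hρl _ hq.2), mem_univ _⟩
    · intro q hq
      change t (g₂ (ρ (t q), f₂ q)) ∈ U
      rw [h₂.time_symm _ (hbV (hρl _ hq.2))]
      exact hbU (hρl _ hq.2)
  have sG₂ : ContMDiffOn (𝓘(ℝ, ℝ).prod 𝓘(ℝ, E)) 𝓘(ℝ, ℝ × E) ∞ G₂ ((V ∩ Ioi l) ×ˢ univ) := by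
    refine h₂.contMDiffOn_symm.comp (ContMDiffOn.prodMk contMDiff_fst.contMDiffOn
      (h₂.contMDiffOn_fst.comp (h₁.contMDiffOn_symm.comp
        (ContMDiffOn.prodMk (hρ.contMDiff.comp contMDiff_fst).contMDiffOn contMDiffOn_snd)
        ?_) ?_)) ?_
    · exact fun x hx => ⟨hbU (hρl _ hx.1.2), mem_univ _⟩
    · intro x hx
      change t (g₁ (ρ x.1, x.2)) ∈ V
      rw [h₁.time_symm _ (hbU (hρl _ hx.1.2))]
      exact hbV (hρl _ hx.1.2)
    · exact fun x hx => ⟨hx.1.1, mem_univ _⟩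
  have hO₁ : IsOpen (U ∩ Iio a) := hU.inter isOpen_Iio
  have hO₂ : IsOpen (V ∩ Ioi l) := hV.inter isOpen_Ioi
  refine ⟨f, g, ⟨?_, ?_, ?_, ?_, ?_⟩, ef₁, eg₁⟩
  · exact contMDiffOn_of_union ht hO₁ hO₂ (h₁.contMDiffOn_fst.mono fun q hq => hq.1) sF₂
      (fun q hq => ef₁ q hq.2) ef₂
  · exact contMDiffOn_symm_of_union hO₁ hO₂
      (h₁.contMDiffOn_symm.mono (prod_mono inter_subset_left subset_rfl)) sG₂
      (fun s hs => eg₁ s hs.2) eg₂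
  · rintro s (hs | hs) m
    · rw [eg₁ s hs.2, h₁.time_symm s hs.1]
    · rw [eg₂ s hs, h₂.time_symm s hs.1]
  · rintro s (hs | hs) m
    · rw [eg₁ s hs.2, ef₁ _ (by rw [h₁.time_symm s hs.1]; exact hs.2), h₁.apply_symm s hs.1]
    · have hρs := hρl s hs.2
      rw [eg₂ s hs, ef₂ _ (by rw [h₂.time_symm s hs.1]; exact hs)]
      simp only [F₂, G₂]
      rw [h₂.time_symm s hs.1, h₂.apply_symm s hs.1]
      have h3 := h₂.symm_apply (g₁ (ρ s, m)) (by rw [h₁.time_symm _ (hbU hρs)]; exact hbV hρs)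
      rw [h₁.time_symm _ (hbU hρs)] at h3
      rw [h3, h₁.apply_symm _ (hbU hρs)]
  · rintro q (hq | hq)
    · rw [ef₁ q hq.2, eg₁ _ hq.2, h₁.symm_apply q hq.1]
    · have hρs := hρl _ hq.2
      rw [ef₂ q hq, eg₂ _ hq]
      simp only [F₂, G₂]
      have h3 := h₁.symm_apply (g₂ (ρ (t q), f₂ q))
        (by rw [h₂.time_symm _ (hbV hρs)]; exact hbU hρs)
      rw [h₂.time_symm _ (hbV hρs)] at h3
      rw [h3, h₂.apply_symm _ (hbV hρs), h₂.symm_apply q hq.1]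

/-- A product structure over `(l, x]` extends over `[x, y]` if there is one over the latter. -/
theorem extend (ht : ContMDiff 𝓘(ℝ, ℝ × E) 𝓘(ℝ, ℝ) ∞ t) (hU : IsOpen U) (hV : IsOpen V)
    (h₁ : IsProductOver (E := E) t U f₁ g₁) (h₂ : IsProductOver (E := E) t V f₂ g₂)
    {l x y : ℝ} (hlx : l < x) (hlU : Ioc l x ⊆ U) (hxV : Icc x y ⊆ V) (hxy : x ≤ y) :
    ∃ (W : Set ℝ) (f : Q → M) (g : ℝ × M → Q), IsOpen W ∧ Ioc l y ⊆ W ∧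
      IsProductOver (E := E) t W f g ∧
      (∀ q, t q ≤ x → f q = f₁ q) ∧ ∀ s ≤ x, ∀ m, g (s, m) = g₁ (s, m) := by
  obtain ⟨δ, hδ, hb⟩ := Metric.isOpen_iff.1 (hU.inter hV) x
    ⟨hlU ⟨hlx, le_rfl⟩, hxV ⟨le_rfl, hxy⟩⟩
  rw [Real.ball_eq_Ioo] at hb
  obtain ⟨f, g, h, hf, hg⟩ := glue ht hU hV h₁ h₂ (l := x - δ) (a := x + δ / 2) (b := x + δ)
    (by linarith) (by linarith) (fun s hs => (hb hs).1) (fun s hs => (hb hs).2)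
  refine ⟨_, f, g, (hU.inter isOpen_Iio).union (hV.inter isOpen_Ioi), ?_, h,
    fun q hq => hf q (by linarith), fun s hs => hg s (by linarith)⟩
  rintro s ⟨hs1, hs2⟩
  rcases le_total s x with h | h
  · exact Or.inl ⟨hlU ⟨hs1, h⟩, by simp only [mem_Iio]; linarith⟩
  · exact Or.inr ⟨hxV ⟨h, hs2⟩, by simp only [mem_Ioi]; linarith⟩

theorem exists_Icc (ht : ContMDiff 𝓘(ℝ, ℝ × E) 𝓘(ℝ, ℝ) ∞ t)
    (hloc : ∀ x : ℝ, ∃ (U : Set ℝ) (f : Q → M) (g : ℝ × M → Q), IsOpen U ∧ x ∈ U ∧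
      IsProductOver (E := E) t U f g) {a b : ℝ} (hab : a ≤ b) :
    ∃ (U : Set ℝ) (f : Q → M) (g : ℝ × M → Q), IsOpen U ∧ Icc a b ⊆ U ∧
      IsProductOver (E := E) t U f g := by
  choose U f g hUo hxU hU using hloc
  -- With a Lebesgue number `δ`, steps of length `δ / 2` keep each new piece within the ball about
  -- the current endpoint. The left margin `δ / 2` puts `a` itself inside the half-open interval.
  obtain ⟨δ, hδ, hball⟩ := lebesgue_number_lemma_of_metric (isCompact_Icc (a := a) (b := b)) hUo
    (fun x _ => mem_iUnion.2 ⟨x, hxU x⟩)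
  have key : ∀ n : ℕ, ∃ (U : Set ℝ) (f : Q → M) (g : ℝ × M → Q), IsOpen U ∧
      Ioc (a - δ / 2) (min b (a + n * (δ / 2))) ⊆ U ∧ IsProductOver (E := E) t U f g := by
    intro n
    induction n with
    | zero =>
      obtain ⟨i, hi⟩ := hball a ⟨le_rfl, hab⟩
      rw [Real.ball_eq_Ioo] at hi
      refine ⟨U i, f i, g i, hUo i, fun s hs => hi ⟨by linarith [hs.1], ?_⟩, hU i⟩
      have := hs.2.trans (min_le_right _ _)
      simp only [CharP.cast_eq_zero, zero_mul, add_zero] at this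
      linarith
    | succ n ih =>
      obtain ⟨W, f', g', hWo, hW, h'⟩ := ih
      have hx : min b (a + n * (δ / 2)) ∈ Icc a b :=
        ⟨le_min hab (le_add_of_nonneg_right (by positivity)), min_le_left _ _⟩
      obtain ⟨i, hi⟩ := hball _ hx
      rw [Real.ball_eq_Ioo] at hi
      have hle : min b (a + ((n + 1 : ℕ) : ℝ) * (δ / 2)) ≤ min b (a + n * (δ / 2)) + δ / 2 := by
        rw [← min_add_add_right]
        refine min_le_min (by linarith) ?_
        push_cast
        linarith
      have hmono : min b (a + n * (δ / 2)) ≤ min b (a + ((n + 1 : ℕ) : ℝ) * (δ / 2)) := by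
        refine min_le_min le_rfl ?_
        push_cast
        linarith
      obtain ⟨W', f'', g'', hW'o, hW', h'', -⟩ := extend ht hWo (hUo i) h' (hU i)
        (by linarith [hx.1]) hW
        (fun s hs => hi ⟨by linarith [hs.1], by linarith [hs.2]⟩) hmono
      exact ⟨W', f'', g'', hW'o, hW', h''⟩
  obtain ⟨n, hn⟩ := exists_nat_ge ((b - a) / (δ / 2))
  rw [div_le_iff₀ (by linarith)] at hn
  obtain ⟨W, f', g', hWo, hW, h'⟩ := key n
  rw [min_eq_left (by linarith)] at hW
  exact ⟨W, f', g', hWo, fun s hs => hW ⟨by linarith [hs.1], hs.2⟩, h'⟩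

/-- Extend by one unit of time repeatedly. Each extension leaves everything up to the previous
endpoint unchanged, so the sequence is eventually constant at each time and its limit is locally one
of its members. -/
theorem exists_Ioi (ht : ContMDiff 𝓘(ℝ, ℝ × E) 𝓘(ℝ, ℝ) ∞ t)
    (hloc : ∀ x : ℝ, ∃ (U : Set ℝ) (f : Q → M) (g : ℝ × M → Q), IsOpen U ∧ x ∈ U ∧
      IsProductOver (E := E) t U f g) {l c : ℝ} (hlc : l < c) (hU : IsOpen U)
    (hlU : Ioc l c ⊆ U) (h₁ : IsProductOver (E := E) t U f₁ g₁) :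
    ∃ (f : Q → M) (g : ℝ × M → Q), IsProductOver (E := E) t (Ioi l) f g ∧
      (∀ q, t q ≤ c → f q = f₁ q) ∧ ∀ s ≤ c, ∀ m, g (s, m) = g₁ (s, m) := by
  let Good : ℕ → (Q → M) × (ℝ × M → Q) → Prop := fun n p =>
    ∃ W, IsOpen W ∧ Ioc l (c + n) ⊆ W ∧ IsProductOver (E := E) t W p.1 p.2
  -- Placing `Good n p` inside the existential lets `choose` produce a total `next`, so the
  -- recursion carries no proofs.
  have step : ∀ (n : ℕ) (p : (Q → M) × (ℝ × M → Q)), ∃ p' : (Q → M) × (ℝ × M → Q), Good n p →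
      Good (n + 1) p' ∧ (∀ q, t q ≤ c + n → p'.1 q = p.1 q) ∧
        ∀ s ≤ c + n, ∀ m, p'.2 (s, m) = p.2 (s, m) := by
    intro n p
    by_cases hp : Good n p
    · obtain ⟨W, hWo, hW, h⟩ := hp
      obtain ⟨V, f₂, g₂, hVo, hV, h₂⟩ := exists_Icc ht hloc
        (show c + n ≤ c + ((n + 1 : ℕ) : ℝ) by push_cast; linarith)
      obtain ⟨W', f', g', hW'o, hW', h', hf, hg⟩ := extend ht hWo hVo h h₂
        (by have : (0 : ℝ) ≤ n := n.cast_nonneg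
            linarith) hW hV (by push_cast; linarith)
      exact ⟨(f', g'), fun _ => ⟨⟨W', hW'o, hW', h'⟩, hf, hg⟩⟩
    · exact ⟨p, fun h => absurd h hp⟩
  choose next hnext using step
  let p : ℕ → (Q → M) × (ℝ × M → Q) := fun n => Nat.rec (f₁, g₁) next n
  have hp : ∀ n, Good n (p n) := by
    intro n
    induction n with
    | zero => exact ⟨U, hU, by simpa using hlU, h₁⟩
    | succ n ih => exact (hnext n (p n) ih).1
  have hpf : ∀ n m : ℕ, n ≤ m → ∀ q, t q ≤ c + n → (p m).1 q = (p n).1 q := by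
    intro n m hnm
    induction m, hnm using Nat.le_induction with
    | base => exact fun _ _ => rfl
    | succ m hm ih =>
      intro q hq
      have hm' : (n : ℝ) ≤ m := by exact_mod_cast hm
      exact ((hnext m (p m) (hp m)).2.1 q (by linarith)).trans (ih q hq)
  have hpg : ∀ n m : ℕ, n ≤ m → ∀ s ≤ c + n, ∀ x, (p m).2 (s, x) = (p n).2 (s, x) := by
    intro n m hnm
    induction m, hnm using Nat.le_induction with
    | base => exact fun _ _ _ => rfl
    | succ m hm ih =>
      intro s hs x
      have hm' : (n : ℝ) ≤ m := by exact_mod_cast hm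
      exact ((hnext m (p m) (hp m)).2.2 s (by linarith) x).trans (ih s hs x)
  let N : ℝ → ℕ := fun s => ⌈s - c⌉₊
  have hN : ∀ s, s ≤ c + N s := fun s => by have := Nat.le_ceil (s - c); simp only [N]; linarith
  let f : Q → M := fun q => (p (N (t q))).1 q
  let g : ℝ × M → Q := fun x => (p (N x.1)).2 x
  have ef : ∀ (n : ℕ) (q : Q), t q ≤ c + n → f q = (p n).1 q := fun n q hq =>
    (hpf _ n (Nat.ceil_le.2 (by linarith)) q (hN _)).symm
  have eg : ∀ (n : ℕ) (s : ℝ), s ≤ c + n → ∀ x, g (s, x) = (p n).2 (s, x) := fun n s hs x =>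
    (hpg _ n (Nat.ceil_le.2 (by linarith)) s (hN _) x).symm
  have good : ∀ s, l < s → ∃ (n : ℕ) (W : Set ℝ), IsOpen W ∧ s ∈ W ∧ W ⊆ Iic (c + n) ∧
      IsProductOver (E := E) t W (p n).1 (p n).2 := by
    intro s hs
    obtain ⟨n, hn⟩ := exists_nat_gt (s - c)
    obtain ⟨W, hWo, hW, h⟩ := hp n
    refine ⟨n, W ∩ Iio (c + n), hWo.inter isOpen_Iio, ⟨hW ⟨hs, by linarith⟩, ?_⟩,
      fun x hx => mem_Iic.2 (mem_Iio.1 hx.2).le, ⟨?_, ?_, ?_, ?_, ?_⟩⟩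
    · simp only [mem_Iio]; linarith
    · exact h.contMDiffOn_fst.mono fun q hq => hq.1
    · exact h.contMDiffOn_symm.mono (prod_mono inter_subset_left subset_rfl)
    · exact fun s hs => h.time_symm s hs.1
    · exact fun s hs => h.apply_symm s hs.1
    · exact fun q hq => h.symm_apply q hq.1
  refine ⟨f, g, ⟨?_, ?_, ?_, ?_, ?_⟩, fun q hq => ef 0 q (by simpa using hq),
    fun s hs => eg 0 s (by simpa using hs)⟩
  · intro q hq
    obtain ⟨n, W, hWo, hW, hWn, h⟩ := good (t q) hq
    exact ((h.contMDiffOn_fst.congr fun x hx => ef n x (hWn hx)).contMDiffAt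
      ((hWo.preimage ht.continuous).mem_nhds hW)).contMDiffWithinAt
  · rintro ⟨s, m⟩ hs
    obtain ⟨n, W, hWo, hW, hWn, h⟩ := good s hs.1
    exact ((h.contMDiffOn_symm.congr fun x hx => eg n x.1 (hWn hx.1) x.2).contMDiffAt
      ((hWo.prod isOpen_univ).mem_nhds ⟨hW, mem_univ _⟩)).contMDiffWithinAt
  · intro s hs m
    obtain ⟨n, W, hWo, hW, hWn, h⟩ := good s hs
    rw [eg n s (hWn hW), h.time_symm s hW]
  · intro s hs m
    obtain ⟨n, W, hWo, hW, hWn, h⟩ := good s hs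
    rw [eg n s (hWn hW), ef n _ (by rw [h.time_symm s hW]; exact hWn hW), h.apply_symm s hW]
  · intro q hq
    obtain ⟨n, W, hWo, hW, hWn, h⟩ := good (t q) hq
    rw [ef n q (hWn hW), eg n _ (hWn hW), h.symm_apply q hW]

/-- A smooth locally trivial bundle over `ℝ` is trivial. -/
theorem exists_univ (ht : ContMDiff 𝓘(ℝ, ℝ × E) 𝓘(ℝ, ℝ) ∞ t)
    (hloc : ∀ x : ℝ, ∃ (U : Set ℝ) (f : Q → M) (g : ℝ × M → Q), IsOpen U ∧ x ∈ U ∧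
      IsProductOver (E := E) t U f g) :
    ∃ (f : Q → M) (g : ℝ × M → Q), IsProductOver (E := E) t univ f g := by
  obtain ⟨U, f₀, g₀, hU, h0U, h₀⟩ := hloc 0
  obtain ⟨δ, hδ, hb⟩ := Metric.isOpen_iff.1 hU 0 h0U
  rw [Real.ball_eq_Ioo, zero_sub, zero_add] at hb
  obtain ⟨f₁, g₁, h₁, hf₁, hg₁⟩ := exists_Ioi ht hloc (l := -δ) (c := δ / 2) (by linarith) hU
    (fun s hs => hb ⟨hs.1, by linarith [hs.2]⟩) h₀
  -- The negative half-line follows by time reversal from the same `h₀`. Both extensions agree with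
  -- it for times strictly between `-δ / 2` and `δ / 2`, hence can be joined at `0`.
  have ht' : ContMDiff 𝓘(ℝ, ℝ × E) 𝓘(ℝ, ℝ) ∞ fun q => -t q := contDiff_neg.contMDiff.comp ht
  obtain ⟨f₂, g₂', h₂', hf₂, hg₂'⟩ := exists_Ioi (t := fun q => -t q) ht' (fun x => by
    obtain ⟨V, f, g, hV, hx, h⟩ := hloc (-x)
    exact ⟨_, f, _, hV.preimage continuous_neg, hx, h.reverse⟩) (l := -δ) (c := δ / 2)
    (by linarith) (hU.preimage continuous_neg)
    (fun s hs => hb ⟨by linarith [hs.2], by linarith [hs.1]⟩) h₀.reverse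
  have h₂ := h₂'.reverse
  simp only [neg_neg] at h₂
  set g₂ : ℝ × M → Q := fun x => g₂' (-x.1, x.2) with hg₂d
  have hg₂ : ∀ s, -(δ / 2) ≤ s → ∀ m, g₂ (s, m) = g₀ (s, m) := by
    intro s hs m
    have := hg₂' (-s) (by linarith) m
    simpa using this
  let f : Q → M := fun q => if t q < 0 then f₂ q else f₁ q
  let g : ℝ × M → Q := fun x => if x.1 < 0 then g₂ x else g₁ x
  have ef₂ : ∀ q, t q < δ / 2 → f q = f₂ q := by
    intro q hq
    by_cases h : t q < 0
    · exact if_pos h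
    · rw [hf₂ q (by linarith), ← hf₁ q hq.le]
      exact if_neg h
  have ef₁ : ∀ q, -(δ / 2) < t q → f q = f₁ q := by
    intro q hq
    by_cases h : t q < 0
    · rw [hf₁ q (by linarith), ← hf₂ q (by linarith)]
      exact if_pos h
    · exact if_neg h
  have eg₂ : ∀ s < δ / 2, ∀ m, g (s, m) = g₂ (s, m) := by
    intro s hs m
    by_cases h : s < 0
    · exact if_pos h
    · rw [hg₂ s (by linarith), ← hg₁ s hs.le]
      exact if_neg h
  have eg₁ : ∀ s, -(δ / 2) < s → ∀ m, g (s, m) = g₁ (s, m) := by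
    intro s hs m
    by_cases h : s < 0
    · rw [hg₁ s (by linarith), ← hg₂ s (by linarith)]
      exact if_pos h
    · exact if_neg h
  have hu : (univ : Set ℝ) = Iio (δ / 2) ∪ Ioi (-(δ / 2)) := by
    refine (eq_univ_of_forall fun s => ?_).symm
    rcases lt_or_ge s 0 with h | h
    · exact Or.inl (by simp only [mem_Iio]; linarith)
    · exact Or.inr (by simp only [mem_Ioi]; linarith)
  have hs₂ : ∀ s ∈ Iio (δ / 2), s ∈ Neg.neg ⁻¹' Ioi (-δ) := fun s hs => by
    simp only [mem_Iio, mem_preimage, mem_Ioi] at hs ⊢; linarith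
  have hs₁ : ∀ s ∈ Ioi (-(δ / 2)), s ∈ Ioi (-δ) := fun s hs => by
    simp only [mem_Ioi] at hs ⊢; linarith
  refine ⟨f, g, ?_⟩
  rw [hu]
  refine ⟨?_, ?_, ?_, ?_, ?_⟩
  · exact contMDiffOn_of_union ht isOpen_Iio isOpen_Ioi
      (h₂.contMDiffOn_fst.mono fun q hq => hs₂ _ hq)
      (h₁.contMDiffOn_fst.mono fun q hq => hs₁ _ hq) ef₂ ef₁
  · exact contMDiffOn_symm_of_union isOpen_Iio isOpen_Ioi
      (h₂.contMDiffOn_symm.mono fun x hx => ⟨hs₂ _ hx.1, mem_univ _⟩)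
      (h₁.contMDiffOn_symm.mono fun x hx => ⟨hs₁ _ hx.1, mem_univ _⟩) eg₂ eg₁
  · rintro s (hs | hs) m
    · rw [eg₂ s hs, h₂.time_symm s (hs₂ s hs)]
    · rw [eg₁ s hs, h₁.time_symm s (hs₁ s hs)]
  · rintro s (hs | hs) m
    · rw [eg₂ s hs, ef₂ _ (by rw [h₂.time_symm s (hs₂ s hs)]; exact hs),
        h₂.apply_symm s (hs₂ s hs)]
    · rw [eg₁ s hs, ef₁ _ (by rw [h₁.time_symm s (hs₁ s hs)]; exact hs),
        h₁.apply_symm s (hs₁ s hs)]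
  · rintro q (hq | hq)
    · rw [ef₂ q hq, eg₂ _ hq, h₂.symm_apply q (hs₂ _ hq)]
    · rw [ef₁ q hq, eg₁ _ hq, h₁.symm_apply q (hs₁ _ hq)]

end IsProductOver

/-- `Q` contracts smoothly to its fibre over the time `0`. -/
theorem ConfigurationBundle.exists_contraction (B : ConfigurationBundle E M Q) :
    ∃ H : ℝ × Q → Q, ContMDiff (𝓘(ℝ, ℝ).prod 𝓘(ℝ, ℝ × E)) 𝓘(ℝ, ℝ × E) ∞ H ∧
      (∀ q, H (1, q) = q) ∧ ∀ q, B.time (H (0, q)) = 0 := by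
  obtain ⟨f, g, h⟩ := IsProductOver.exists_univ (E := E) (M := M) B.contMDiff_time (fun x => by
    obtain ⟨U, φ, hU, hx, hs, htar, hfst, hφ, hφ'⟩ := B.locally_trivial x
    refine ⟨U, fun q => (φ q).2, φ.symm, hU, hx, ?_, ?_, ?_, ?_, ?_⟩
    · rw [← hs]
      exact contMDiff_snd.comp_contMDiffOn hφ
    · rwa [← htar]
    · intro s hsU m
      have hm : (s, m) ∈ φ.target := by rw [htar]; exact ⟨hsU, mem_univ _⟩
      rw [← hfst _ (φ.map_target hm), φ.right_inv hm]
    · intro s hsU m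
      have hm : (s, m) ∈ φ.target := by rw [htar]; exact ⟨hsU, mem_univ _⟩
      rw [φ.right_inv hm]
    · intro q hq
      have hq' : q ∈ φ.source := by rw [hs]; exact hq
      rw [← hfst q hq']
      exact φ.left_inv hq')
  have hf : ContMDiff 𝓘(ℝ, ℝ × E) 𝓘(ℝ, E) ∞ f := contMDiffOn_univ.1 (by
    simpa using h.contMDiffOn_fst)
  have hg : ContMDiff (𝓘(ℝ, ℝ).prod 𝓘(ℝ, E)) 𝓘(ℝ, ℝ × E) ∞ g := contMDiffOn_univ.1 (by
    simpa using h.contMDiffOn_symm)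
  -- In the global product structure the contraction multiplies time by the parameter and fixes the
  -- `M`-coordinate.
  refine ⟨fun x => g (x.1 * B.time x.2, f x.2), ?_, fun q => ?_, fun q => ?_⟩
  · refine hg.comp (ContMDiff.prodMk ?_ (hf.comp contMDiff_snd))
    exact contDiff_mul.contMDiff.comp
      (contMDiff_fst.prodMk_space (B.contMDiff_time.comp contMDiff_snd))
  · simpa using h.symm_apply q (mem_univ _)
  · simpa using h.time_symm 0 (mem_univ _) (f q)

end Trivializations

/-! ### Canonical forms of the Legendre bundle in coordinates. -/

section LegendreForms

/-- The coordinate expression `pᵢ dqⁱ ∧ dt` of the canonical 2-form at the point `x = (t, q, p)`. -/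
def standardThetaAt {E : Type*} [NormedAddCommGroup E] [NormedSpace ℝ E]
    (x : (ℝ × E) × (E →L[ℝ] ℝ)) : ((ℝ × E) × (E →L[ℝ] ℝ)) [⋀^Fin 2]→L[ℝ] ℝ where
  toFun u := x.2 ((u 1).1.1 • (u 0).1.2 - (u 0).1.1 • (u 1).1.2)
  map_update_add' := by
    intro inst u i a b
    have : inst = instDecidableEqFin 2 := Subsingleton.elim _ _
    subst this
    fin_cases i <;> simp <;> ring
  map_update_smul' := by
    intro inst u i c a
    have : inst = instDecidableEqFin 2 := Subsingleton.elim _ _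
    subst this
    fin_cases i <;> simp <;> ring
  map_eq_zero_of_eq' := by
    intro u i j hu hij
    have h : u 0 = u 1 := by
      fin_cases i <;> fin_cases j <;> simp_all
    simp [h]
  cont := x.2.continuous.comp (by fun_prop)

theorem norm_standardThetaAt_le {E : Type*} [NormedAddCommGroup E] [NormedSpace ℝ E]
    (x : (ℝ × E) × (E →L[ℝ] ℝ)) : ‖standardThetaAt x‖ ≤ 2 * ‖x‖ := by
  refine ContinuousAlternatingMap.opNorm_le_bound _ (by positivity) fun u => ?_
  rw [Fin.prod_univ_two]
  have h1 : ∀ i, ‖(u i).1.1‖ ≤ ‖u i‖ := fun i => (norm_fst_le _).trans (norm_fst_le _)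
  have h2 : ∀ i, ‖(u i).1.2‖ ≤ ‖u i‖ := fun i => (norm_snd_le _).trans (norm_fst_le _)
  have h3 : ‖(u 1).1.1 • (u 0).1.2 - (u 0).1.1 • (u 1).1.2‖ ≤ 2 * (‖u 0‖ * ‖u 1‖) := by
    refine (norm_sub_le _ _).trans ?_
    rw [norm_smul, norm_smul]
    have := mul_le_mul (h1 1) (h2 0) (norm_nonneg _) (norm_nonneg _)
    have := mul_le_mul (h1 0) (h2 1) (norm_nonneg _) (norm_nonneg _)
    linarith [mul_comm ‖u 0‖ ‖u 1‖]
  calc ‖x.2 ((u 1).1.1 • (u 0).1.2 - (u 0).1.1 • (u 1).1.2)‖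
      ≤ ‖x.2‖ * ‖(u 1).1.1 • (u 0).1.2 - (u 0).1.1 • (u 1).1.2‖ := x.2.le_opNorm _
    _ ≤ ‖x‖ * (2 * (‖u 0‖ * ‖u 1‖)) :=
      mul_le_mul (norm_snd_le x) h3 (norm_nonneg _) (norm_nonneg _)
    _ = 2 * ‖x‖ * (‖u 0‖ * ‖u 1‖) := by ring

/-- The form `pᵢ dqⁱ ∧ dt`, as a linear function of the point. -/
def standardTheta (E : Type*) [NormedAddCommGroup E] [NormedSpace ℝ E] :
    ((ℝ × E) × (E →L[ℝ] ℝ)) →L[ℝ] ((ℝ × E) × (E →L[ℝ] ℝ)) [⋀^Fin 2]→L[ℝ] ℝ :=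
  let T : ((ℝ × E) × (E →L[ℝ] ℝ)) →ₗ[ℝ] ((ℝ × E) × (E →L[ℝ] ℝ)) [⋀^Fin 2]→L[ℝ] ℝ :=
    { toFun := standardThetaAt
      map_add' := fun _ _ => ContinuousAlternatingMap.ext fun _ => rfl
      map_smul' := fun _ _ => ContinuousAlternatingMap.ext fun _ => rfl }
  LinearMap.mkContinuous (E := (ℝ × E) × (E →L[ℝ] ℝ))
    (F := ((ℝ × E) × (E →L[ℝ] ℝ)) [⋀^Fin 2]→L[ℝ] ℝ) T 2 norm_standardThetaAt_le

variable {E M Q : Type*} [NormedAddCommGroup E] [NormedSpace ℝ E]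
  [TopologicalSpace M] [ChartedSpace E M] [TopologicalSpace Q] [ChartedSpace (ℝ × E) Q]

theorem standardTheta_apply (x : (ℝ × E) × (E →L[ℝ] ℝ))
    (u : Fin 2 → (ℝ × E) × (E →L[ℝ] ℝ)) :
    standardTheta E x u = x.2 ((u 1).1.1 • (u 0).1.2 - (u 0).1.1 • (u 1).1.2) := rfl

theorem contDiff_standardTheta (E : Type*) [NormedAddCommGroup E] [NormedSpace ℝ E] :
    ContDiff ℝ ∞ (standardTheta E) :=
  ContinuousLinearMap.contDiff (𝕜 := ℝ) (E := (ℝ × E) × (E →L[ℝ] ℝ))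
    (F := ((ℝ × E) × (E →L[ℝ] ℝ)) [⋀^Fin 2]→L[ℝ] ℝ) (standardTheta E)

/-- `dpᵢ ∧ dqⁱ ∧ dt` vanishes on two vertical vectors tangent to the zero section. -/
theorem extDeriv_standardTheta_eq_zero (x : (ℝ × E) × (E →L[ℝ] ℝ))
    (u : Fin 3 → (ℝ × E) × (E →L[ℝ] ℝ)) (h₁ : (u 1).2 = 0) (h₂ : (u 2).2 = 0)
    (h₁' : (u 1).1.1 = 0) (h₂' : (u 2).1.1 = 0) : extDeriv (standardTheta E) x u = 0 := by
  -- `standardTheta` is linear, so it is its own derivative. Differentiation along `u 0` leaves dqⁱ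
  -- ∧ dt on two vectors without time component; along `u 1` or `u 2` it replaces the momentum by
  -- zero.
  rw [extDeriv, ContinuousLinearMap.fderiv, ContinuousAlternatingMap.alternatizeUncurryFin_apply,
    Fin.sum_univ_three]
  simp [standardTheta_apply, h₁, h₂, h₁', h₂', Fin.removeNth, Fin.tail]

namespace ConfigurationBundle

variable [IsManifold 𝓘(ℝ, E) ∞ M] (B : ConfigurationBundle E M Q)

/-- The fibred chart used to trivialize `V*Q` around `q₀`. -/
def fibredChart (q₀ : Q) : OpenPartialHomeomorph Q (ℝ × E) := (B.exists_isFibredChart q₀).choose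

theorem isFibredChart_fibredChart (q₀ : Q) : B.IsFibredChart (B.fibredChart q₀) :=
  (B.exists_isFibredChart q₀).choose_spec.1

theorem mem_fibredChart_source (q₀ : Q) : q₀ ∈ (B.fibredChart q₀).source :=
  (B.exists_isFibredChart q₀).choose_spec.2

/-- The trivialization of `V*Q` around `q₀`. -/
abbrev legendreTrivialization (q₀ : Q) : Trivialization (E →L[ℝ] ℝ)
    (π (E →L[ℝ] ℝ) (fun q : Q => B.VerticalSpace q →L[ℝ] Trivial Q ℝ q)) :=
  trivializationAt (E →L[ℝ] ℝ) (fun q : Q => B.VerticalSpace q →L[ℝ] Trivial Q ℝ q) q₀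

theorem legendreTrivialization_baseSet (q₀ : Q) :
    (B.legendreTrivialization q₀).baseSet = (B.fibredChart q₀).source := by
  rw [legendreTrivialization, hom_trivializationAt_baseSet]
  exact inter_univ _

/-- The momentum coordinates `pᵢ` on `V*Q` around `q₀`. -/
def momentum (q₀ : Q) (z : B.Legendre) : E →L[ℝ] ℝ := (B.legendreTrivialization q₀ z).2

/-- The trivialization of a bundle of homomorphisms conjugates by those of source and target. The
target is the trivial line bundle, so only the inverse of the trivialization of VQ remains. -/
theorem momentum_apply (q₀ : Q) {q : Q} (hq : q ∈ (B.fibredChart q₀).source)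
    (α : B.VerticalSpace q →L[ℝ] ℝ) (v : E) :
    B.momentum q₀ ⟨q, α⟩ v =
      α (((B.isFibredChart_fibredChart q₀).vertEquiv hq).symm v) := by
  rw [← (B.isFibredChart_fibredChart q₀).pretrivialization_symm hq]
  rw [momentum, legendreTrivialization, hom_trivializationAt_apply]
  have h1 : (trivializationAt E B.VerticalSpace q₀).symmL ℝ q v =
      (B.isFibredChart_fibredChart q₀).pretrivialization.symm q v := by
    rw [Trivialization.symmL_apply]
    · rfl
    · exact hq
  have h2 : ∀ x : ℝ, (trivializationAt ℝ (Trivial Q ℝ) q₀).continuousLinearMapAt ℝ q x = x := by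
    intro x
    rw [Trivialization.continuousLinearMapAt_apply,
      Trivialization.coe_linearMapAt_of_mem _ (mem_univ q)]
    rfl
  rw [← h1]
  exact h2 _

theorem momentum_smul (q₀ : Q) {q : Q} (hq : q ∈ (B.fibredChart q₀).source) (c : ℝ)
    (α : B.VerticalSpace q →L[ℝ] ℝ) :
    B.momentum q₀ ⟨q, c • α⟩ = c • B.momentum q₀ ⟨q, α⟩ := by
  ext v
  exact (B.momentum_apply q₀ hq (c • α) v).trans
    (congrArg (fun x => c • x) (B.momentum_apply q₀ hq α v).symm)

theorem contMDiffAt_momentum {q₀ : Q} {z : B.Legendre} (hz : z.proj ∈ (B.fibredChart q₀).source) :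
    ContMDiffAt (LegendreModel E) 𝓘(ℝ, E →L[ℝ] ℝ) ∞ (B.momentum q₀) z := by
  have h := ((B.legendreTrivialization q₀).contMDiffOn (IB := 𝓘(ℝ, ℝ × E)) (n := ∞)).contMDiffAt
    (x := z) ((B.legendreTrivialization q₀).open_source.mem_nhds (by
      rw [Trivialization.mem_source, legendreTrivialization_baseSet]
      exact hz))
  exact contMDiffAt_snd.comp z h

theorem contMDiff_legendre_proj :
    ContMDiff (LegendreModel E) 𝓘(ℝ, ℝ × E) ∞ (fun z : B.Legendre => z.proj) :=
  Bundle.contMDiff_proj _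

/-- The coordinates `(t, qⁱ, pᵢ)` of `V*Q` around `q₀`. -/
def darboux (q₀ : Q) (z : B.Legendre) : (ℝ × E) × (E →L[ℝ] ℝ) :=
  (B.fibredChart q₀ z.proj, B.momentum q₀ z)

theorem contMDiffAt_darboux {q₀ : Q} {z : B.Legendre} (hz : z.proj ∈ (B.fibredChart q₀).source) :
    ContMDiffAt (LegendreModel E) 𝓘(ℝ, (ℝ × E) × (E →L[ℝ] ℝ)) ∞ (B.darboux q₀) z := by
  refine ContMDiffAt.prodMk_space ?_ (B.contMDiffAt_momentum hz)
  exact ((B.isFibredChart_fibredChart q₀).contMDiffOn.contMDiffAt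
    ((B.fibredChart q₀).open_source.mem_nhds hz)).comp z B.contMDiff_legendre_proj.contMDiffAt

theorem mfderiv_darboux_fst {q₀ : Q} {z : B.Legendre} (hz : z.proj ∈ (B.fibredChart q₀).source)
    (w : TangentSpace (LegendreModel E) z) :
    (mfderiv (LegendreModel E) 𝓘(ℝ, (ℝ × E) × (E →L[ℝ] ℝ)) (B.darboux q₀) z w :
      (ℝ × E) × (E →L[ℝ] ℝ)).1 = IsFibredChart.D (B.fibredChart q₀) z.proj
        (mfderiv (LegendreModel E) 𝓘(ℝ, ℝ × E) (fun z : B.Legendre => z.proj) z w) := by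
  have h1 : HasMFDerivAt (LegendreModel E) 𝓘(ℝ, ℝ × E) (fun z => (B.darboux q₀ z).1) z
      ((ContinuousLinearMap.fst ℝ (ℝ × E) (E →L[ℝ] ℝ)).comp
        (mfderiv (LegendreModel E) 𝓘(ℝ, (ℝ × E) × (E →L[ℝ] ℝ)) (B.darboux q₀) z)) :=
    HasMFDerivAt.comp z (hasFDerivAt_fst.hasMFDerivAt)
      ((B.contMDiffAt_darboux hz).mdifferentiableAt (by simp)).hasMFDerivAt
  have h2 := HasMFDerivAt.comp z
    ((B.isFibredChart_fibredChart q₀).mdifferentiableAt hz).hasMFDerivAt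
    (B.contMDiff_legendre_proj.mdifferentiableAt (x := z) (by simp)).hasMFDerivAt
  exact DFunLike.congr_fun (hasMFDerivAt_unique h1 h2) w

/-- In the coordinates `(t, qⁱ, pᵢ)` the canonical 2-form is `pᵢ dqⁱ ∧ dt`. -/
theorem Theta_eq_pullTo {q₀ : Q} {z : B.Legendre} (hz : z.proj ∈ (B.fibredChart q₀).source) :
    B.Theta z = DiffForm.pullTo (LegendreModel E) (B.darboux q₀) (standardTheta E) z := by
  obtain ⟨q, α⟩ := z
  have he := B.isFibredChart_fibredChart q₀
  ext u
  let w : Fin 2 → TangentSpace 𝓘(ℝ, ℝ × E) q := fun i =>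
    mfderiv (LegendreModel E) 𝓘(ℝ, ℝ × E) (fun z : B.Legendre => z.proj) ⟨q, α⟩ (u i)
  let D : TangentSpace 𝓘(ℝ, ℝ × E) q →L[ℝ] ℝ × E := IsFibredChart.D (B.fibredChart q₀) q
  have hD : ∀ i, (mfderiv (LegendreModel E) 𝓘(ℝ, (ℝ × E) × (E →L[ℝ] ℝ)) (B.darboux q₀) ⟨q, α⟩
      (u i) : (ℝ × E) × (E →L[ℝ] ℝ)).1 = D (w i) := fun i => B.mfderiv_darboux_fst hz (u i)
  change α ⟨B.dt q (w 1) • w 0 - B.dt q (w 0) • w 1, _⟩ =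
    B.momentum q₀ ⟨q, α⟩ ((mfderiv (LegendreModel E) 𝓘(ℝ, (ℝ × E) × (E →L[ℝ] ℝ)) (B.darboux q₀)
      ⟨q, α⟩ (u 1) : (ℝ × E) × (E →L[ℝ] ℝ)).1.1 •
        (mfderiv (LegendreModel E) 𝓘(ℝ, (ℝ × E) × (E →L[ℝ] ℝ)) (B.darboux q₀)
      ⟨q, α⟩ (u 0) : (ℝ × E) × (E →L[ℝ] ℝ)).1.2 -
      (mfderiv (LegendreModel E) 𝓘(ℝ, (ℝ × E) × (E →L[ℝ] ℝ)) (B.darboux q₀)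
      ⟨q, α⟩ (u 0) : (ℝ × E) × (E →L[ℝ] ℝ)).1.1 •
        (mfderiv (LegendreModel E) 𝓘(ℝ, (ℝ × E) × (E →L[ℝ] ℝ)) (B.darboux q₀)
      ⟨q, α⟩ (u 1) : (ℝ × E) × (E →L[ℝ] ℝ)).1.2)
  rw [hD 0, hD 1, B.momentum_apply q₀ hz]
  refine congrArg α ?_
  rw [ContinuousLinearEquiv.eq_symm_apply]
  change (D (B.dt q (w 1) • w 0 - B.dt q (w 0) • w 1)).2 = _
  rw [map_sub, map_smul, map_smul, ← he.D_fst hz, ← he.D_fst hz]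
  rfl

theorem eventually_proj_mem (z : B.Legendre) {q₀ : Q}
    (hz : z.proj ∈ (B.fibredChart q₀).source) :
    ∀ᶠ x : B.Legendre in 𝓝 z, x.proj ∈ (B.fibredChart q₀).source :=
  B.contMDiff_legendre_proj.continuous.continuousAt.eventually
    ((B.fibredChart q₀).open_source.mem_nhds hz)

/-- The zero section of `V*Q`. -/
def zeroLegendre (q : Q) : B.Legendre := ⟨q, 0⟩

theorem contMDiff_zeroLegendre :
    ContMDiff 𝓘(ℝ, ℝ × E) (LegendreModel E) ∞ B.zeroLegendre :=
  Bundle.contMDiff_zeroSection ℝ (fun q : Q => B.VerticalSpace q →L[ℝ] Trivial Q ℝ q)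

/-- Fibrewise scaling of `V*Q`. -/
def scaling (x : ℝ × B.Legendre) : B.Legendre := ⟨x.2.proj, x.1 • x.2.snd⟩

theorem contMDiff_scaling :
    ContMDiff (𝓘(ℝ, ℝ).prod (LegendreModel E)) (LegendreModel E) ∞ B.scaling := by
  intro x
  rw [contMDiffAt_totalSpace]
  have hx := B.mem_fibredChart_source x.2.proj
  refine ⟨ContMDiffAt.comp (f := Prod.snd) x B.contMDiff_legendre_proj.contMDiffAt
    contMDiffAt_snd, ?_⟩
  have h : ContMDiffAt (𝓘(ℝ, ℝ).prod (LegendreModel E)) 𝓘(ℝ, E →L[ℝ] ℝ) ∞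
      (fun y : ℝ × B.Legendre => y.1 • B.momentum x.2.proj y.2) x :=
    contMDiffAt_fst.smul ((B.contMDiffAt_momentum hx).comp x contMDiffAt_snd)
  refine h.congr_of_eventuallyEq ?_
  filter_upwards [continuousAt_snd.eventually (B.eventually_proj_mem x.2 hx)] with y hy
  exact B.momentum_smul x.2.proj hy y.1 y.2.snd

variable [IsManifold 𝓘(ℝ, ℝ × E) ∞ Q]

theorem isSmooth_Theta : B.Theta.IsSmooth :=
  DiffForm.isSmooth_of_pullTo fun z => ⟨B.darboux z.proj, standardTheta E,
    B.contMDiffAt_darboux (B.mem_fibredChart_source z.proj), (contDiff_standardTheta E),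
    (B.eventually_proj_mem z (B.mem_fibredChart_source z.proj)).mono fun _ hx =>
      B.Theta_eq_pullTo hx⟩

theorem Omega_eq_pullTo {q₀ : Q} {z : B.Legendre} (hz : z.proj ∈ (B.fibredChart q₀).source) :
    B.Omega z =
      DiffForm.pullTo (LegendreModel E) (B.darboux q₀) (extDeriv (standardTheta E)) z :=
  DiffForm.d_eq_pullTo (B.contMDiffAt_darboux hz) (contDiff_standardTheta E)
    ((B.eventually_proj_mem z hz).mono fun _ hx => B.Theta_eq_pullTo hx)

/-- `γ ⌋ Ω` vanishes on the zero section over a fixed time. -/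
theorem pullback_contract_Omega_eq_zero (X : ∀ z : B.Legendre, TangentSpace (LegendreModel E) z)
    {G : B.Legendre → Q} (hG : ContMDiff (LegendreModel E) 𝓘(ℝ, ℝ × E) ∞ G) {c : ℝ}
    (hc : ∀ z, B.time (G z) = c) :
    (B.Omega.contract X).pullback (fun z => B.zeroLegendre (G z)) = 0 := by
  funext z
  ext v
  have hz := B.mem_fibredChart_source (G z)
  have hg : MDifferentiableAt (LegendreModel E) (LegendreModel E)
      (fun z => B.zeroLegendre (G z)) z :=
    (B.contMDiff_zeroLegendre.comp hG).mdifferentiableAt (by simp)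
  have hd := (B.contMDiffAt_darboux (z := B.zeroLegendre (G z)) hz).mdifferentiableAt
    (n := ∞) (by simp)
  have h1 := HasMFDerivAt.comp z hd.hasMFDerivAt hg.hasMFDerivAt
  have h0 : ∀ᶠ x in 𝓝 z, G x ∈ (B.fibredChart (G z)).source :=
    hG.continuous.continuousAt.eventually ((B.fibredChart (G z)).open_source.mem_nhds hz)
  let L := (mfderiv (LegendreModel E) 𝓘(ℝ, (ℝ × E) × (E →L[ℝ] ℝ)) (B.darboux (G z))
    (B.zeroLegendre (G z))).comp
      (mfderiv (LegendreModel E) (LegendreModel E) (fun z => B.zeroLegendre (G z)) z)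
  have hp : ∀ w, (L w : (ℝ × E) × (E →L[ℝ] ℝ)).2 = 0 := by
    have h2 : HasMFDerivAt (LegendreModel E) 𝓘(ℝ, E →L[ℝ] ℝ)
        (fun x => (B.darboux (G z) (B.zeroLegendre (G x))).2) z
        ((ContinuousLinearMap.snd ℝ (ℝ × E) (E →L[ℝ] ℝ)).comp L) :=
      HasMFDerivAt.comp (f := fun x => B.darboux (G z) (B.zeroLegendre (G x))) z
        hasFDerivAt_snd.hasMFDerivAt h1
    have h3 := (hasMFDerivAt_const (I := LegendreModel E) (I' := 𝓘(ℝ, E →L[ℝ] ℝ))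
      (0 : E →L[ℝ] ℝ) z).congr_of_eventuallyEq
      (f₁ := fun x => (B.darboux (G z) (B.zeroLegendre (G x))).2) (by
        filter_upwards [h0] with x hx
        -- Homogeneity with factor `0` shows that the momentum coordinates vanish on the zero
        -- section.
        have := B.momentum_smul (G z) hx 0 0
        rw [zero_smul, zero_smul] at this
        exact this)
    exact fun w => DFunLike.congr_fun (hasMFDerivAt_unique h2 h3) w
  have ht : ∀ w, (L w : (ℝ × E) × (E →L[ℝ] ℝ)).1.1 = 0 := by
    have h2 : HasMFDerivAt (LegendreModel E) 𝓘(ℝ, ℝ)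
        (fun x => (B.darboux (G z) (B.zeroLegendre (G x))).1.1) z
        (((ContinuousLinearMap.fst ℝ ℝ E).comp
          (ContinuousLinearMap.fst ℝ (ℝ × E) (E →L[ℝ] ℝ))).comp L) :=
      HasMFDerivAt.comp (f := fun x => B.darboux (G z) (B.zeroLegendre (G x))) z
        ((ContinuousLinearMap.fst ℝ ℝ E).comp
        (ContinuousLinearMap.fst ℝ (ℝ × E) (E →L[ℝ] ℝ))).hasFDerivAt.hasMFDerivAt h1
    have h3 := (hasMFDerivAt_const (I := LegendreModel E) (I' := 𝓘(ℝ, ℝ))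
      c z).congr_of_eventuallyEq
      (f₁ := fun x => (B.darboux (G z) (B.zeroLegendre (G x))).1.1) (by
        filter_upwards [h0] with x hx
        exact ((B.isFibredChart_fibredChart (G z)).fst_eq _ hx).trans (hc x))
    exact fun w => DFunLike.congr_fun (hasMFDerivAt_unique h2 h3) w
  change B.Omega (B.zeroLegendre (G z)) _ = 0
  rw [B.Omega_eq_pullTo (q₀ := G z) hz]
  -- The contraction puts `X` in slot `0`, so `v 0` and `v 1` sit in slots `1` and `2`.
  exact extDeriv_standardTheta_eq_zero _ _ (hp (v 0)) (hp (v 1)) (ht (v 0)) (ht (v 1))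


end ConfigurationBundle

end LegendreForms

end

/-! ### Exactness by concatenating the two homotopies. -/

theorem mainTheorem8 {E M Q : Type*}
    [NormedAddCommGroup E] [NormedSpace ℝ E] [FiniteDimensional ℝ E]
    [TopologicalSpace M] [ChartedSpace E M] [IsManifold 𝓘(ℝ, E) ∞ M]
    [TopologicalSpace Q] [ChartedSpace (ℝ × E) Q] [IsManifold 𝓘(ℝ, ℝ × E) ∞ Q]
    (B : ConfigurationBundle E M Q) (γ : B.LegendreConnection) (hγ : γ.IsCanonical) :
    (B.Omega.contract γ.field).IsExact := by
  obtain ⟨H, hH, hH₁, hH₀⟩ := B.exists_contraction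
  have hs : (B.Omega.contract γ.field).IsSmooth :=
    B.isSmooth_Theta.d.contract γ.contMDiff_field
  let G : ℝ × B.Legendre → B.Legendre := fun x => B.zeroLegendre (H (x.1, x.2.proj))
  have hG' : ContMDiff (𝓘(ℝ, ℝ).prod (ConfigurationBundle.LegendreModel E)) 𝓘(ℝ, ℝ × E) ∞
      (fun x : ℝ × B.Legendre => H (x.1, x.2.proj)) :=
    hH.comp (contMDiff_fst.prodMk (B.contMDiff_legendre_proj.comp contMDiff_snd))
  have hG : ContMDiff (𝓘(ℝ, ℝ).prod (ConfigurationBundle.LegendreModel E))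
      (ConfigurationBundle.LegendreModel E) ∞ G := B.contMDiff_zeroLegendre.comp hG'
  refine ⟨DiffForm.homotopyOperator B.scaling (B.Omega.contract γ.field) +
    DiffForm.homotopyOperator G (B.Omega.contract γ.field),
    (DiffForm.isSmooth_homotopyOperator hs B.contMDiff_scaling).add
      (DiffForm.isSmooth_homotopyOperator hs hG), ?_⟩
  rw [DiffForm.IsSmooth.d_add (DiffForm.isSmooth_homotopyOperator hs B.contMDiff_scaling)
    (DiffForm.isSmooth_homotopyOperator hs hG),
    DiffForm.IsClosed.d_homotopyOperator hγ hs B.contMDiff_scaling,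
    DiffForm.IsClosed.d_homotopyOperator hγ hs hG]
  have h1 : (fun z => B.scaling (1, z)) = fun z => z :=
    funext fun z => congrArg (TotalSpace.mk z.proj) (one_smul ℝ z.snd)
  -- The scaling ends where the second homotopy starts, at the zero section composed with the
  -- projection, so the two intermediate pull-backs cancel.
  have h2 : (fun z => B.scaling (0, z)) = fun z => G (1, z) := funext fun z => by
    have h3 : G (1, z) = B.zeroLegendre z.proj := congrArg B.zeroLegendre (hH₁ z.proj)
    rw [h3]
    exact congrArg (TotalSpace.mk z.proj) (zero_smul ℝ z.snd)
  rw [h1, h2, DiffForm.pullback_id, B.pullback_contract_Omega_eq_zero γ.field (c := 0)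
    (G := fun z => H (0, z.proj)) (hH.comp (contMDiff_const.prodMk B.contMDiff_legendre_proj))
    (fun z => hH₀ _)]
  abel
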